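/- Let $V$ be a two-sided quaternionic Banach space, let $(\mathcal U_T(t))_{t\in\mathbb R}$ be a strongly continuous group of bounded right linear operators on $V$ with infinitesimal generator $T$, and let $M>0$, $\omega\ge 0$ be constants with $\|\mathcal U_T(t)\|\le Me^{\omega|t|}$ for all $t\in\mathbb R$. Let $\mu$ be a quaternionic measure on the Borel sets of $\mathbb R$ with $\int_{\mathbb R}e^{(\omega+\varepsilon)|t|}\,d|\mu|(t)<\infty$ for some $\varepsilon>0$, let $$f(s)=\int_{\mathbb R}d\mu(t)\,e^{-st},\qquad -(\omega+\varepsilon)<\operatorname{Re}(s)<\omega+\varepsilon,$$ be its bilateral Laplace-Stieltjes transform, a function whose domain is this strip, and let $$f(T)v=\int_{\mathbb R}d\mu(t)\,\mathcal U_T(-t)v,\qquad v\in V.$$ For $c>0$ let $W_c=\{s\in\mathbb H:-c<\operatorname{Re}(s)<c\}$. For a quaternion $s$ such that $T^2-2\operatorname{Re}(s)T+|s|^2\mathcal I:\mathcal D(T^2)\to V$ has a bounded inverse defined on all of $V$, that is, for $s$ in the $S$-resolvent set $\rho_S(T)$, let $$S_R^{-1}(s,T)=-(T-\overline{s}\,\mathcal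 I)(T^2-2\operatorname{Re}(s)T+|s|^2\mathcal I)^{-1}.$$ Let $\alpha$ and $c$ be real numbers with $\omega<c<|\alpha|$, and suppose that $f$ is right slice regular on $\overline{W_c}$, that is, on an open set which contains $\overline{W_c}$ and is contained in the domain of $f$. Let $I$ be a purely imaginary unit quaternion and $\mathbb C_I=\mathbb R+I\mathbb R$. Then $\partial(W_c\cap\mathbb C_I)\subset\rho_S(T)$, and for every $u\in\mathcal D(T^2)$ $$f(T)u=\frac1{2\pi}\int_{\partial(W_c\cap\mathbb C_I)}f(s)(\alpha-s)^{-2}\,ds_I\,S_R^{-1}(s,T)(\alpha\mathcal I-T)^2u,$$ where both the integral that defines $f(T)u$ and the integral on the right converge absolutely, $ds_I=-ds\,I$, and $\partial(W_c\cap\mathbb C_I)$ consists of the lines $s=c+I\tau$ and $s=-c-I\tau$, $\tau\in\mathbb R$, each run through in the direction of increasing $\tau$ (positive orientation). -/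

import Mathlib

open MeasureTheory Filter Topology
open scoped Quaternion

noncomputable section

namespace QuatCalc

/-! ### Quaternions and slice regular functions -/

/-- The sphere `𝕊` of purely imaginary unit quaternions. -/
def imagUnits : Set ℍ[ℝ] := {I | I.re = 0 ∧ ‖I‖ = 1}

/-- The open strip `W_r = {s ∈ ℍ : -r < Re s < r}`. -/
def strip (r : ℝ) : Set ℍ[ℝ] := {s | -r < s.re ∧ s.re < r}

/-- Right slice regularity on an open set `O`: `f` is real differentiable on `O` and, for every
`I ∈ 𝕊`, the restriction of `f` to the plane `ℂ_I` satisfies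
`(1/2) (∂f/∂x₀ + (∂f/∂x₁) I) = 0` at the points `x₀ + I x₁` of `O`. -/
def RightSliceRegularOn (f : ℍ[ℝ] → ℍ[ℝ]) (O : Set ℍ[ℝ]) : Prop :=
  IsOpen O ∧ DifferentiableOn ℝ f O ∧
    ∀ I ∈ imagUnits, ∀ x₀ x₁ : ℝ, (x₀ : ℍ[ℝ]) + x₁ • I ∈ O →
      (1 / 2 : ℝ) • (deriv (fun t : ℝ => f ((t : ℍ[ℝ]) + x₁ • I)) x₀
        + deriv (fun t : ℝ => f ((x₀ : ℍ[ℝ]) + t • I)) x₁ * I) = 0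

/-- A function `f` with domain `D` is right slice regular on a (not necessarily open) set `K`:
it is right slice regular on an open subset of its domain that contains `K`. -/
def RightSliceRegularNear (D : Set ℍ[ℝ]) (f : ℍ[ℝ] → ℍ[ℝ]) (K : Set ℍ[ℝ]) : Prop :=
  ∃ O : Set ℍ[ℝ], K ⊆ O ∧ O ⊆ D ∧ RightSliceRegularOn f O

/-! ### Quaternionic measures and the Laplace-Stieltjes transform

A quaternionic measure is a `VectorMeasure` with values in `ℍ[ℝ]`, `μ.variation` is its total
variation `|μ|`, and `∫ dμ(t) F(t)`, with the measure on the left of the integrand, is the integral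
against `μ` with respect to the pairing `(x, q) ↦ q x`. -/

/-- The transform `𝓛(μ)(s) = ∫ dμ(t) e^{-st}`. -/
def laplaceStieltjes (μ : VectorMeasure ℝ ℍ[ℝ]) (s : ℍ[ℝ]) : ℍ[ℝ] :=
  μ.integral (fun t : ℝ => NormedSpace.exp (-(t • s))) (ContinuousLinearMap.mul ℝ ℍ[ℝ]).flip

/-- `f`, regarded as a function with domain `D`, is the bilateral Laplace-Stieltjes transform of
`μ` relative to the growth exponent `ω`: for some `ε > 0` the measure satisfies
`∫ e^{(ω+ε)|t|} d|μ|(t) < ∞`, the domain `D` is the strip `-(ω+ε) < Re s < ω+ε`, and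
`f(s) = ∫ dμ(t) e^{-st}` for `s ∈ D`. -/
def IsLaplaceStieltjesTransform (ω : ℝ) (μ : VectorMeasure ℝ ℍ[ℝ])
    (D : Set ℍ[ℝ]) (f : ℍ[ℝ] → ℍ[ℝ]) : Prop :=
  ∃ ε : ℝ, 0 < ε ∧ Integrable (fun t : ℝ => Real.exp ((ω + ε) * |t|)) μ.variation ∧
    D = strip (ω + ε) ∧ ∀ s ∈ D, f s = laplaceStieltjes μ s

/-! ### Operators on a two-sided quaternionic Banach space

The left multiplication `q v` is `q • v`, the right multiplication `v q` is the action of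
`MulOpposite.op q`. -/

section Operators

variable {V : Type*} [NormedAddCommGroup V] [NormedSpace ℝ V]
  [Module ℍ[ℝ] V] [IsBoundedSMul ℍ[ℝ] V] [IsScalarTower ℝ ℍ[ℝ] V]
  [Module ℍ[ℝ]ᵐᵒᵖ V] [IsBoundedSMul ℍ[ℝ]ᵐᵒᵖ V] [IsScalarTower ℝ ℍ[ℝ]ᵐᵒᵖ V]
  [SMulCommClass ℍ[ℝ] ℍ[ℝ]ᵐᵒᵖ V]

/-- A strongly continuous group of bounded right linear operators. -/
structure IsStronglyContinuousGroup (U : ℝ → V →L[ℍ[ℝ]ᵐᵒᵖ] V) : Prop where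
  zero : ∀ v, U 0 v = v
  add : ∀ s t v, U (s + t) v = U s (U t v)
  continuous : ∀ v, Continuous fun t => U t v

/-- `T` is the infinitesimal generator of `U`: its domain consists of the vectors `v` for which
`lim_{h → 0+} (U(h)v - v)/h` exists, and `T v` is this limit. -/
def IsGenerator (U : ℝ → V →L[ℍ[ℝ]ᵐᵒᵖ] V) (T : V →ₗ.[ℍ[ℝ]ᵐᵒᵖ] V) : Prop :=
  (∀ v : V, v ∈ T.domain ↔
    ∃ w : V, Tendsto (fun h : ℝ => h⁻¹ • (U h v - v)) (𝓝[>] 0) (𝓝 w)) ∧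
  ∀ v : T.domain, Tendsto (fun h : ℝ => h⁻¹ • (U h (v : V) - (v : V))) (𝓝[>] 0) (𝓝 (T v))

/-- The domain of `T²`. -/
def domSq (T : V →ₗ.[ℍ[ℝ]ᵐᵒᵖ] V) : Set V :=
  {u | ∃ h : u ∈ T.domain, T ⟨u, h⟩ ∈ T.domain}

/-- `(T² - 2 Re(s) T + |s|² 𝓘) u` for `u ∈ 𝓓(T²)`. -/
def pseudoResolventMap (T : V →ₗ.[ℍ[ℝ]ᵐᵒᵖ] V) (s : ℍ[ℝ]) (u : domSq T) : V :=
  T ⟨T ⟨u, u.2.1⟩, u.2.2⟩ - (2 * s.re) • T ⟨u, u.2.1⟩ + (‖s‖ ^ 2) • (u : V)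

/-- `Q` is the inverse of `T² - 2 Re(s) T + |s|² 𝓘 : 𝓓(T²) → V`, as a bounded right linear
operator on `V`. -/
def IsPseudoResolvent (T : V →ₗ.[ℍ[ℝ]ᵐᵒᵖ] V) (s : ℍ[ℝ]) (Q : V →L[ℍ[ℝ]ᵐᵒᵖ] V) : Prop :=
  (∀ v : V, ∃ h : Q v ∈ domSq T, pseudoResolventMap T s ⟨Q v, h⟩ = v) ∧
  ∀ u : domSq T, Q (pseudoResolventMap T s u) = u

/-- The `S`-resolvent set `ρ_S(T)`. -/
def sResolventSet (T : V →ₗ.[ℍ[ℝ]ᵐᵒᵖ] V) : Set ℍ[ℝ] :=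
  {s | ∃ Q : V →L[ℍ[ℝ]ᵐᵒᵖ] V, IsPseudoResolvent T s Q}

/-- The right `S`-resolvent operator
`S_R⁻¹(s,T) v = -(T - s̄ 𝓘)(T² - 2 Re(s) T + |s|² 𝓘)⁻¹ v` for `s ∈ ρ_S(T)`
(and `0` for `s ∉ ρ_S(T)`). -/
def rightSResolvent (T : V →ₗ.[ℍ[ℝ]ᵐᵒᵖ] V) (s : ℍ[ℝ]) (v : V) : V :=
  open Classical in
  if h : s ∈ sResolventSet T then
    -(T ⟨h.choose v, (h.choose_spec.1 v).1.1⟩ - star s • h.choose v)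
  else 0

/-- `(α𝓘 - T) u` for `u ∈ 𝓓(T)` and real `α`. -/
def realShift (T : V →ₗ.[ℍ[ℝ]ᵐᵒᵖ] V) (α : ℝ) (u : T.domain) : V :=
  α • (u : V) - T u

/-- `(α𝓘 - T)² u = (α𝓘 - T)((α𝓘 - T) u)` for `u ∈ 𝓓(T²)` and real `α`. -/
def realShiftSq (T : V →ₗ.[ℍ[ℝ]ᵐᵒᵖ] V) (α : ℝ) (u : domSq T) : V :=
  realShift T α ⟨realShift T α ⟨u, u.2.1⟩,
    T.domain.sub_mem (T.domain.smul_of_tower_mem α u.2.1) u.2.2⟩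

/-- The operator `f(T) v = ∫ dμ(t) U(-t) v`, where `f` is the Laplace-Stieltjes transform of `μ`
and `T` is the generator of the group `U`. -/
def laplaceCalculus (U : ℝ → V →L[ℍ[ℝ]ᵐᵒᵖ] V) (μ : VectorMeasure ℝ ℍ[ℝ]) (v : V) : V :=
  μ.integral (fun t : ℝ => U (-t) v) (ContinuousLinearMap.lsmul ℝ ℍ[ℝ]).flip

/-! ### The integral over the boundary of a strip -/

/-- The right boundary line `s = c + Iτ` of `W_c ∩ ℂ_I`, in the direction of increasing `τ`. -/
def rightLine (c : ℝ) (I : ℍ[ℝ]) (τ : ℝ) : ℍ[ℝ] := (c : ℍ[ℝ]) + τ • I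

/-- The left boundary line `s = -c - Iτ` of `W_c ∩ ℂ_I`, in the direction of increasing `τ`. -/
def leftLine (c : ℝ) (I : ℍ[ℝ]) (τ : ℝ) : ℍ[ℝ] := -(c : ℍ[ℝ]) - τ • I

/-- The integrand, in the parameter `τ`, of `∫_γ F(s) ds_I G(s)`, where `ds_I = -ds I`. -/
def sliceIntegrand (I : ℍ[ℝ]) (γ : ℝ → ℍ[ℝ]) (F : ℍ[ℝ] → ℍ[ℝ]) (G : ℍ[ℝ] → V) (τ : ℝ) : V :=
  (F (γ τ) * (-(deriv γ τ * I))) • G (γ τ)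

/-- `∫_{∂(W_c ∩ ℂ_I)} F(s) ds_I G(s)`, over the positively oriented boundary. -/
def stripBoundaryIntegral (c : ℝ) (I : ℍ[ℝ]) (F : ℍ[ℝ] → ℍ[ℝ]) (G : ℍ[ℝ] → V) : V :=
  (∫ τ : ℝ, sliceIntegrand I (rightLine c I) F G τ) +
    ∫ τ : ℝ, sliceIntegrand I (leftLine c I) F G τ

/-- The integral over `∂(W_c ∩ ℂ_I)` converges absolutely. -/
def StripBoundaryIntegrable (c : ℝ) (I : ℍ[ℝ]) (F : ℍ[ℝ] → ℍ[ℝ]) (G : ℍ[ℝ] → V) : Prop :=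
  Integrable (sliceIntegrand I (rightLine c I) F G) ∧
    Integrable (sliceIntegrand I (leftLine c I) F G)

end Operators

end QuatCalc

end

namespace QuatCalc

/-! ### Integrals against finite dimensional vector measures -/

section FiniteDimensional

variable {X F : Type*} {mX : MeasurableSpace X} [NormedAddCommGroup F] [NormedSpace ℝ F]

/-! Everything reduces to the exponentials `s ↦ e^{-st}`. In coordinates of ℍ, the Jordan
decomposition writes `μ` as a finite sum of finite positive measures `ν j` with coefficients `q j`,
each dominated by a multiple of |μ| (`exists_eq_sum_measure_smul`). Hence f(s) = ∑ q_j ∫ e^{-st}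
dν_j(t), and f(T)u splits in the same way. The containment of the closed strip in the domain of f
forces c < ω + ε, so e^{c|t|} is |μ|-integrable and Fubini applies on each boundary line
(`integrable_and_integral_line`). With w = (α - T)²u, it remains to see that for each t the boundary
integral of e^{-st}(α - s)^{-2} ds_I S_R^{-1}(s,T)w equals 2π U(-t)u.

Write a boundary point as s = σz with σ = ±1 and z = c + Iτ. There S_R^{-1}(s,T)w = σ ∫₀^∞ e^{-zr}
U(σr)w dr (`smul_rightLine_mem_and_eq`), and ds_I = σ dτ, so the signs cancel. All scalar factors
lie in the commutative plane ℂ_I and stand to the left of U(σr)w. Integrating first in τ is thus a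
complex Laplace inversion (`integral_expIntegrand`), which yields 2π k(t + σr), where k is the
inverse transform of (α - s)^{-2} on the strip: with α = εβ, β = |α|, it is k(y) = max(εy, 0)
e^{-βεy}.

The two lines contribute the halves r > 0 and r < 0 of ∫ k(t + r) U(r)w dr = U(-t) ∫ k(y) U(y)w dy.
The last integral is u, being the Laplace formula for the square of the resolvent at α applied to (α
- T)²u (`integral_group_realShiftSq`). No contour is shifted: the two lines glue the half-line
integrals to one over ℝ (`integral_expIntegrand_add`). -/

lemma variation_mapRange_le (μ : VectorMeasure X F) (L : F →L[ℝ] ℝ) :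
    (μ.mapRange L.toLinearMap.toAddMonoidHom L.continuous).variation ≤ ‖L‖₊ • μ.variation := by
  apply VectorMeasure.variation_le_of_forall_enorm_le (fun s hs ↦ ?_)
  change ‖L (μ s)‖ₑ ≤ _
  rw [Measure.smul_apply]
  grw [ContinuousLinearMap.le_opENorm, VectorMeasure.enorm_measure_le_variation]
  rfl

/-- A vector measure with values in a finite dimensional space is a finite combination of finite
positive measures which are dominated by its variation. -/
lemma exists_eq_sum_measure_smul [FiniteDimensional ℝ F] (μ : VectorMeasure X F) :
    ∃ (n : ℕ) (ν : Fin n × Bool → Measure X) (q : Fin n × Bool → F) (C : NNReal),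
      (∀ j, IsFiniteMeasure (ν j)) ∧ (∀ j, ν j ≤ C • μ.variation) ∧
      ∀ s, MeasurableSet s → μ s = ∑ j, (ν j).real s • q j := by
  let b := Module.finBasis ℝ F
  let L : Fin (Module.finrank ℝ F) → (F →L[ℝ] ℝ) := fun i => (b.coord i).toContinuousLinearMap
  let σ : Fin (Module.finrank ℝ F) → SignedMeasure X := fun i =>
    μ.mapRange (L i).toLinearMap.toAddMonoidHom (L i).continuous
  -- The index is a coordinate together with a sign: the measures are the Jordan parts of the
  -- coordinate functions of `μ`, and the sign is carried by the vector `± b i`. The sum of the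
  -- coordinate norms is a constant that serves all indices at once.
  refine ⟨_, fun j => if j.2 then (σ j.1).toJordanDecomposition.posPart else
    (σ j.1).toJordanDecomposition.negPart, fun j => if j.2 then b j.1 else -b j.1,
    ∑ i, ‖L i‖₊, ?_, ?_, ?_⟩
  · rintro ⟨i, _ | _⟩ <;> simp <;> infer_instance
  · rintro ⟨i, k⟩
    have h1 : (σ i).totalVariation ≤ (∑ i, ‖L i‖₊) • μ.variation := by
      rw [SignedMeasure.totalVariation_eq_variation]
      refine (variation_mapRange_le μ (L i)).trans ?_
      gcongr
      exact Finset.single_le_sum (f := fun i => ‖L i‖₊) (fun _ _ => zero_le) (Finset.mem_univ i)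
    refine le_trans ?_ h1
    unfold SignedMeasure.totalVariation
    cases k
    · exact Measure.le_add_left le_rfl
    · exact Measure.le_add_right le_rfl
  · intro s hs
    rw [Fintype.sum_prod_type]
    conv_lhs => rw [← b.sum_repr (μ s)]
    refine Finset.sum_congr rfl fun i _ => ?_
    have := SignedMeasure.apply_eq_posPart_real_sub_negPart_real (σ i) hs
    have h2 : b.repr (μ s) i = σ i s := rfl
    rw [h2, this, sub_smul]
    simp [sub_eq_add_neg]

variable {E G : Type*} [NormedAddCommGroup E] [NormedSpace ℝ E] [CompleteSpace E]
  [NormedAddCommGroup G] [NormedSpace ℝ G] [CompleteSpace G]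

/-- Both sides are additive and continuous in `f` for the L¹ norm of the variation, so the
hypothesis on sets, which is the case of indicators, suffices. This replaces the vector measure by
ordinary Bochner integrals, for which Fubini is at hand. -/
lemma vectorMeasure_integral_eq_sum {ι : Type*} [Fintype ι] (μ : VectorMeasure X F)
    [IsFiniteMeasure μ.variation] (ν : ι → Measure X) [∀ j, IsFiniteMeasure (ν j)]
    (q : ι → F) (C : NNReal) (hν : ∀ j, ν j ≤ C • μ.variation)
    (hμ : ∀ s, MeasurableSet s → μ s = ∑ j, (ν j).real s • q j)
    (B : E →L[ℝ] F →L[ℝ] G) {f : X → E} (hf : Integrable f μ.variation) :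
    μ.integral f B = ∑ j, B (∫ x, f x ∂(ν j)) (q j) := by
  have hint : ∀ {g : X → E}, Integrable g μ.variation → ∀ j, Integrable g (ν j) :=
    fun {g} hg j => Integrable.of_measure_le_smul (c := (C : ENNReal)) (by simp) (hν j) hg
  have hac : ∀ j, ν j ≪ μ.variation := fun j =>
    Measure.absolutelyContinuous_of_le_smul (c := (C : ENNReal)) (hν j)
  refine Integrable.induction (P := fun f : X → E =>
    μ.integral f B = ∑ j, B (∫ x, f x ∂(ν j)) (q j)) ?_ ?_ ?_ ?_ hf
  · intro c s hs _
    have h1 : μ.integral (s.indicator fun _ => c) B = B c (μ s) := by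
      rw [VectorMeasure.integral_eq_setToFun, setToFun_indicator_const _ hs (measure_ne_top _ _)]
      rfl
    rw [h1, hμ s hs, map_sum]
    refine Finset.sum_congr rfl fun j _ => ?_
    rw [integral_indicator_const _ hs]
    simp
  · intro f g _ hf hg h1 h2
    rw [VectorMeasure.integral_add hf hg, h1, h2, ← Finset.sum_add_distrib]
    refine Finset.sum_congr rfl fun j _ => ?_
    rw [integral_add' (hint hf j) (hint hg j)]
    simp
  · have h1 : Continuous fun f : X →₁[μ.variation] E => μ.integral f B :=
      VectorMeasure.continuous_integral
    have h2 : ∀ j, Continuous fun f : X →₁[μ.variation] E => ∫ x, f x ∂(ν j) := by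
      intro j
      -- Since `ν j` is dominated by a multiple of the variation, its integral is an extension of a
      -- set function relative to the variation, and as such is continuous on that L¹ space.
      have : ∀ f : X →₁[μ.variation] E, ∫ x, f x ∂(ν j) = setToFun μ.variation
          (weightedSMul (ν j)) (DominatedFinMeasAdditive.of_measure_le_smul (c := (C : ENNReal))
            (by simp) (hν j) (dominatedFinMeasAdditive_weightedSMul (ν j)) (by simp)) f := by
        intro f
        rw [integral_eq_setToFun]
        exact (setToFun_congr_measure_of_integrable (C : ENNReal) (by simp) (hν j) _ _ _
          (L1.integrable_coeFn f)).symm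
      simp_rw [this]
      exact continuous_setToFun _
    refine isClosed_eq h1 ?_
    fun_prop
  · intro f g hfg _ h
    rw [← VectorMeasure.integral_congr_ae hfg, h]
    refine Finset.sum_congr rfl fun j _ => ?_
    rw [integral_congr_ae ((hac j).ae_le hfg)]

end FiniteDimensional

/-! ### Strongly continuous groups -/

section Group

set_option linter.unusedSectionVars false

variable {V : Type*} [NormedAddCommGroup V] [NormedSpace ℝ V]
  [Module ℍ[ℝ]ᵐᵒᵖ V] [IsBoundedSMul ℍ[ℝ]ᵐᵒᵖ V] [IsScalarTower ℝ ℍ[ℝ]ᵐᵒᵖ V]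

/-- The bound `‖W t‖ ≤ M e^{ω|t|}`. -/
def HasGrowthBound (W : ℝ → V →L[ℍ[ℝ]ᵐᵒᵖ] V) (M ω : ℝ) : Prop :=
  ∀ (t : ℝ) (v : V), ‖W t v‖ ≤ M * Real.exp (ω * |t|) * ‖v‖

variable {W : ℝ → V →L[ℍ[ℝ]ᵐᵒᵖ] V} {M ω : ℝ}

lemma IsStronglyContinuousGroup.comp_mul (hW : IsStronglyContinuousGroup W) (σ : ℝ) :
    IsStronglyContinuousGroup fun t => W (σ * t) where
  zero v := by simp [hW.zero]
  add s t v := by simp [mul_add, hW.add]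
  continuous v := (hW.continuous v).comp (by fun_prop)

lemma HasGrowthBound.comp_mul (hb : HasGrowthBound W M ω) {σ : ℝ} (hσ : |σ| = 1) :
    HasGrowthBound (fun t => W (σ * t)) M ω := fun t v => by
  simpa [abs_mul, hσ] using hb (σ * t) v

lemma IsStronglyContinuousGroup.continuous_uncurry (hW : IsStronglyContinuousGroup W)
    (hb : HasGrowthBound W M ω) : Continuous fun p : ℝ × V => W p.1 p.2 := by
  rw [continuous_iff_continuousAt]
  rintro ⟨t, w⟩
  have h1 : Tendsto (fun p : ℝ × V => W p.1 (p.2 - w)) (𝓝 (t, w)) (𝓝 0) := by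
    refine squeeze_zero_norm (fun p => hb p.1 (p.2 - w)) ?_
    have : Continuous fun p : ℝ × V => M * Real.exp (ω * |p.1|) * ‖p.2 - w‖ := by fun_prop
    simpa using this.tendsto (t, w)
  have h2 : Tendsto (fun p : ℝ × V => W p.1 w) (𝓝 (t, w)) (𝓝 (W t w)) :=
    ((hW.continuous w).comp continuous_fst).tendsto (t, w)
  simpa [ContinuousAt] using h1.add h2

/-- For t < 0 the difference quotient is W(t) applied to the quotient at -t > 0, and joint
continuity of (t, v) ↦ W(t)v passes to the limit. So the one-sided definition of the generator gives
two-sided derivatives, which allows time reversal. -/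
lemma IsStronglyContinuousGroup.hasDerivAt_zero_of_tendsto (hW : IsStronglyContinuousGroup W)
    (hb : HasGrowthBound W M ω) {v w : V}
    (h : Tendsto (fun h : ℝ => h⁻¹ • (W h v - v)) (𝓝[>] 0) (𝓝 w)) :
    HasDerivAt (fun t => W t v) w 0 := by
  rw [hasDerivAt_iff_tendsto_slope, ← Set.Iio_union_Ioi, nhdsWithin_union]
  have hs : ∀ t : ℝ, slope (fun t => W t v) 0 t = t⁻¹ • (W t v - v) := fun t => by
    simp [slope_def_module, hW.zero]
  simp_rw [funext hs]
  refine Tendsto.sup ?_ h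
  have hneg : Tendsto (fun t : ℝ => -t) (𝓝[<] 0) (𝓝[>] 0) := by
    simpa using tendsto_neg_nhdsLT (a := (0 : ℝ))
  have h1 : Tendsto (fun t : ℝ => (t, (-t)⁻¹ • (W (-t) v - v))) (𝓝[<] 0) (𝓝 (0, w)) :=
    (tendsto_nhdsWithin_of_tendsto_nhds tendsto_id).prodMk_nhds (h.comp hneg)
  have h2 := ((hW.continuous_uncurry hb).tendsto (0, w)).comp h1
  simp only [hW.zero] at h2
  refine h2.congr fun t => ?_
  have h3 : W t (W (-t) v) = v := by rw [← hW.add]; simp [hW.zero]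
  have h4 := ((W t).restrictScalars ℝ).map_smul (-t)⁻¹ (W (-t) v - v)
  simp only [ContinuousLinearMap.coe_restrictScalars', map_sub, h3] at h4
  simp only [Function.comp_apply]
  rw [h4, inv_neg, neg_smul, ← smul_neg, neg_sub]

lemma IsStronglyContinuousGroup.hasDerivAt (hW : IsStronglyContinuousGroup W) {v w : V}
    (h : HasDerivAt (fun t => W t v) w 0) (t : ℝ) :
    HasDerivAt (fun t => W t v) (W t w) t := by
  have h1 : HasDerivAt (fun r => W (r - t) v) w t := by
    have := HasDerivAt.comp_sub_const (f := fun t => W t v) (f' := w) t t (by simpa using h)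
    exact this
  have h2 := ((W t).restrictScalars ℝ).hasFDerivAt.comp_hasDerivAt t h1
  refine h2.congr_of_eventuallyEq (Eventually.of_forall fun r => ?_)
  change W r v = W t (W (r - t) v)
  rw [← hW.add]; congr; ring

lemma IsGenerator.hasDerivAt {T : V →ₗ.[ℍ[ℝ]ᵐᵒᵖ] V} (hT : IsGenerator W T)
    (hW : IsStronglyContinuousGroup W) (hb : HasGrowthBound W M ω) (v : T.domain) :
    HasDerivAt (fun t => W t (v : V)) (T v) 0 :=
  hW.hasDerivAt_zero_of_tendsto hb (hT.2 v)

lemma IsGenerator.exists_of_hasDerivAt {T : V →ₗ.[ℍ[ℝ]ᵐᵒᵖ] V} (hT : IsGenerator W T)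
    (hW : IsStronglyContinuousGroup W) {v w : V} (h : HasDerivAt (fun t => W t v) w 0) :
    ∃ hv : v ∈ T.domain, T ⟨v, hv⟩ = w := by
  rw [hasDerivAt_iff_tendsto_slope] at h
  have h1 : Tendsto (fun h : ℝ => h⁻¹ • (W h v - v)) (𝓝[>] 0) (𝓝 w) := by
    refine (h.mono_left (nhdsWithin_mono 0 fun x (hx : 0 < x) => hx.ne')).congr fun t => ?_
    simp [slope_def_module, hW.zero]
  have hv : v ∈ T.domain := (hT.1 v).2 ⟨w, h1⟩
  exact ⟨hv, tendsto_nhds_unique (hT.2 ⟨v, hv⟩) h1⟩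

/-! ### Exponentially damped integrals along the group -/

lemma integrableOn_Ioi_of_norm_le_exp {E : Type*} [NormedAddCommGroup E] {g : ℝ → E} {C b : ℝ}
    (hb : 0 < b) (hg : Continuous g) (h : ∀ r, 0 < r → ‖g r‖ ≤ C * Real.exp (-b * r)) :
    IntegrableOn g (Set.Ioi 0) :=
  Integrable.mono' ((integrableOn_exp_mul_Ioi (neg_lt_zero.2 hb) 0).const_mul C)
    hg.aestronglyMeasurable ((ae_restrict_iff' measurableSet_Ioi).2 (ae_of_all _ h))

lemma norm_smul_group_le {a C : ℝ} {k : ℝ → ℝ} (hb : HasGrowthBound W M ω)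
    (hC : ∀ r, 0 < r → |k r| ≤ C * Real.exp (-a * r)) (v : V) {r : ℝ} (hr : 0 < r) :
    ‖k r • W r v‖ ≤ C * M * ‖v‖ * Real.exp (-(a - ω) * r) := by
  have h1 := hb r v
  rw [abs_of_pos hr] at h1
  rw [norm_smul, Real.norm_eq_abs]
  calc |k r| * ‖W r v‖ ≤ (C * Real.exp (-a * r)) * (M * Real.exp (ω * r) * ‖v‖) :=
        mul_le_mul (hC r hr) h1 (norm_nonneg _) ((abs_nonneg _).trans (hC r hr))
    _ = C * M * ‖v‖ * Real.exp (-(a - ω) * r) := by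
        rw [show -(a - ω) * r = -a * r + ω * r by ring, Real.exp_add]; ring

lemma integrableOn_smul_group {a C : ℝ} {k : ℝ → ℝ} (hW : IsStronglyContinuousGroup W)
    (hb : HasGrowthBound W M ω) (ha : ω < a) (hk : Continuous k)
    (hC : ∀ r, 0 < r → |k r| ≤ C * Real.exp (-a * r)) (v : V) :
    IntegrableOn (fun r => k r • W r v) (Set.Ioi 0) :=
  integrableOn_Ioi_of_norm_le_exp (sub_pos.2 ha) (hk.smul (hW.continuous v))
    fun _ hr => norm_smul_group_le hb hC v hr

variable [CompleteSpace V]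

/-- The operator `v ↦ ∫₀^∞ k(r) W(r) v dr`, for a real kernel `k` of sufficient decay, is a bounded
right linear operator that commutes with the group. -/
lemma exists_kernel_operator {a C : ℝ} {k : ℝ → ℝ} (hW : IsStronglyContinuousGroup W)
    (hb : HasGrowthBound W M ω) (ha : ω < a) (hk : Continuous k)
    (hC : ∀ r, 0 < r → |k r| ≤ C * Real.exp (-a * r)) :
    ∃ Q : V →L[ℍ[ℝ]ᵐᵒᵖ] V, (∀ v, Q v = ∫ r in Set.Ioi 0, k r • W r v) ∧
      ∀ t v, Q (W t v) = W t (Q v) := by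
  have hint := integrableOn_smul_group hW hb ha hk hC
  let L : V →ₗ[ℍ[ℝ]ᵐᵒᵖ] V :=
    { toFun := fun v => ∫ r in Set.Ioi 0, k r • W r v
      map_add' := fun v w => by
        rw [← integral_add (hint v) (hint w)]
        simp
      map_smul' := fun q v => by
        simp only [RingHom.id_apply]
        rw [← Integrable.integral_smul q (hint v)]
        simp only [map_smul, smul_comm (_ : ℝ) q] }
  refine ⟨L.mkContinuous (∫ r in Set.Ioi (0 : ℝ), C * M * Real.exp (-(a - ω) * r)) fun v => ?_,
    fun v => rfl, fun t v => ?_⟩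
  · have h1 : IntegrableOn (fun r : ℝ => C * M * Real.exp (-(a - ω) * r)) (Set.Ioi 0) :=
      (integrableOn_exp_mul_Ioi (by linarith) 0).const_mul _
    rw [← integral_mul_const]
    refine norm_integral_le_of_norm_le (h1.mul_const _)
      ((ae_restrict_iff' measurableSet_Ioi).2 (ae_of_all _ fun r hr => ?_))
    refine (norm_smul_group_le hb hC v hr).trans_eq (by ring)
  · change ∫ r in Set.Ioi 0, k r • W r (W t v) = W t (∫ r in Set.Ioi 0, k r • W r v)
    have h1 := ((W t).restrictScalars ℝ).integral_comp_comm (hint v)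
    simp only [ContinuousLinearMap.coe_restrictScalars'] at h1
    rw [← h1]
    refine integral_congr_ae (ae_of_all _ fun r => ?_)
    have h2 := ((W t).restrictScalars ℝ).map_smul (k r) (W r v)
    simp only [ContinuousLinearMap.coe_restrictScalars'] at h2
    simp only [h2]
    rw [← hW.add, ← hW.add, add_comm]

end Group

/-! ### Cosine and sine transforms, the real form of the resolvent -/

section Group

set_option linter.unusedSectionVars false

variable {V : Type*} [NormedAddCommGroup V] [NormedSpace ℝ V]
  [Module ℍ[ℝ]ᵐᵒᵖ V] [IsBoundedSMul ℍ[ℝ]ᵐᵒᵖ V] [IsScalarTower ℝ ℍ[ℝ]ᵐᵒᵖ V] [CompleteSpace V]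
  {W : ℝ → V →L[ℍ[ℝ]ᵐᵒᵖ] V} {M ω : ℝ}

lemma integral_Ioi_comp_add {E : Type*} [NormedAddCommGroup E] [NormedSpace ℝ E] (g : ℝ → E)
    (h : ℝ) : ∫ r in Set.Ioi 0, g (h + r) = ∫ r in Set.Ioi h, g r := by
  have := (measurePreserving_add_left volume h).setIntegral_preimage_emb
    (measurableEmbedding_addLeft h) g (Set.Ioi h)
  simpa using this

/-- Translation along the group of an integral over the half line. -/
lemma group_apply_integral {a C : ℝ} {k : ℝ → ℝ} (hW : IsStronglyContinuousGroup W)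
    (hb : HasGrowthBound W M ω) (ha : ω < a) (hk : Continuous k)
    (hC : ∀ r, 0 < r → |k r| ≤ C * Real.exp (-a * r)) (v : V) (h : ℝ) :
    W h (∫ r in Set.Ioi 0, k r • W r v) = ∫ r in Set.Ioi h, k (r - h) • W r v := by
  have h1 := ((W h).restrictScalars ℝ).integral_comp_comm (integrableOn_smul_group hW hb ha hk hC v)
  simp only [ContinuousLinearMap.coe_restrictScalars'] at h1
  rw [← h1, ← integral_Ioi_comp_add (fun r => k (r - h) • W r v) h]
  refine integral_congr_ae (ae_of_all _ fun r => ?_)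
  have h2 := ((W h).restrictScalars ℝ).map_smul (k r) (W r v)
  simp only [ContinuousLinearMap.coe_restrictScalars'] at h2
  simp only [h2]
  rw [← hW.add, add_sub_cancel_left]

lemma abs_exp_mul_cos_le (a b r : ℝ) : |Real.exp (-a * r) * Real.cos (b * r)| ≤
    1 * Real.exp (-a * r) := by
  rw [abs_mul, Real.abs_exp, mul_comm]
  gcongr
  exact Real.abs_cos_le_one _

lemma abs_exp_mul_sin_le (a b r : ℝ) : |Real.exp (-a * r) * Real.sin (b * r)| ≤
    1 * Real.exp (-a * r) := by
  rw [abs_mul, Real.abs_exp, mul_comm]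
  gcongr
  exact Real.abs_sin_le_one _

/-- `∫₀^∞ e^{-ar} cos(br) W(r) v dr`. -/
noncomputable def cosTransform (W : ℝ → V →L[ℍ[ℝ]ᵐᵒᵖ] V) (a b : ℝ) (v : V) : V :=
  ∫ r in Set.Ioi 0, (Real.exp (-a * r) * Real.cos (b * r)) • W r v

/-- `∫₀^∞ e^{-ar} sin(br) W(r) v dr`. -/
noncomputable def sinTransform (W : ℝ → V →L[ℍ[ℝ]ᵐᵒᵖ] V) (a b : ℝ) (v : V) : V :=
  ∫ r in Set.Ioi 0, (Real.exp (-a * r) * Real.sin (b * r)) • W r v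

lemma integrableOn_cos (hW : IsStronglyContinuousGroup W) (hb : HasGrowthBound W M ω) {a : ℝ}
    (ha : ω < a) (b : ℝ) (v : V) : IntegrableOn
    (fun r => (Real.exp (-a * r) * Real.cos (b * r)) • W r v) (Set.Ioi 0) :=
  integrableOn_smul_group hW hb ha (by fun_prop) (fun r _ => abs_exp_mul_cos_le a b r) v

lemma integrableOn_sin (hW : IsStronglyContinuousGroup W) (hb : HasGrowthBound W M ω) {a : ℝ}
    (ha : ω < a) (b : ℝ) (v : V) : IntegrableOn
    (fun r => (Real.exp (-a * r) * Real.sin (b * r)) • W r v) (Set.Ioi 0) :=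
  integrableOn_smul_group hW hb ha (by fun_prop) (fun r _ => abs_exp_mul_sin_le a b r) v

lemma hasDerivAt_integral_smul_group (hW : IsStronglyContinuousGroup W) (v : V) {k : ℝ → ℝ} (hk : Continuous k) :
    HasDerivAt (fun h => ∫ r in (0 : ℝ)..h, k r • W r v) (k 0 • v) 0 := by
  have hc : Continuous fun r => k r • W r v := hk.smul (hW.continuous v)
  have := (hc.integral_hasStrictDerivAt 0 0).hasDerivAt
  simpa [hW.zero] using this

lemma integral_Ioi_eq_sub (hW : IsStronglyContinuousGroup W) (v : V) {k : ℝ → ℝ} (hk : Continuous k)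
    (hi : IntegrableOn (fun r => k r • W r v) (Set.Ioi 0)) (h : ℝ) :
    IntegrableOn (fun r => k r • W r v) (Set.Ioi h) ∧
    ∫ r in Set.Ioi h, k r • W r v =
      (∫ r in Set.Ioi 0, k r • W r v) - ∫ r in (0 : ℝ)..h, k r • W r v := by
  have hc : Continuous fun r => k r • W r v := hk.smul (hW.continuous v)
  have hi' : IntegrableOn (fun r => k r • W r v) (Set.Ioi h) := by
    refine ((hc.integrableOn_Icc (a := h) (b := 0)).union hi).mono_set fun r hr => ?_
    rcases le_or_gt r 0 with h0 | h0
    · exact Or.inl ⟨le_of_lt hr, h0⟩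
    · exact Or.inr h0
  refine ⟨hi', ?_⟩
  rw [← intervalIntegral.integral_Ioi_sub_Ioi' hi hi']
  abel

/-- Translation by h turns the kernel k(r) into k(r - h) on (h, ∞), and the addition theorems
express this through the cosine and sine kernels again. The dependence on h is then explicit enough
to differentiate at 0. The kernels are kept real because real scalars commute with the group,
whereas left multiplication by I need not. -/
lemma group_apply_cosTransform (hW : IsStronglyContinuousGroup W) (hb : HasGrowthBound W M ω) {a : ℝ}
    (ha : ω < a) (b : ℝ) (v : V) (h : ℝ) : W h (cosTransform W a b v) =
    (Real.exp (a * h) * Real.cos (b * h)) •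
      (cosTransform W a b v - ∫ r in (0 : ℝ)..h, (Real.exp (-a * r) * Real.cos (b * r)) • W r v) +
    (Real.exp (a * h) * Real.sin (b * h)) •
      (sinTransform W a b v -
        ∫ r in (0 : ℝ)..h, (Real.exp (-a * r) * Real.sin (b * r)) • W r v) := by
  obtain ⟨hc, hc'⟩ := integral_Ioi_eq_sub hW v (k := fun r => Real.exp (-a * r) * Real.cos (b * r))
    (by fun_prop) (integrableOn_cos hW hb ha b v) h
  obtain ⟨hs, hs'⟩ := integral_Ioi_eq_sub hW v (k := fun r => Real.exp (-a * r) * Real.sin (b * r))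
    (by fun_prop) (integrableOn_sin hW hb ha b v) h
  unfold cosTransform sinTransform
  rw [group_apply_integral hW hb ha (by fun_prop) (fun r _ => abs_exp_mul_cos_le a b r) v h,
    ← hc', ← hs', ← integral_smul, ← integral_smul]
  refine Eq.trans ?_ (integral_add (hc.smul _) (hs.smul _))
  refine integral_congr_ae (ae_of_all _ fun r => ?_)
  simp only [smul_smul, ← add_smul]
  congr 1
  rw [show -a * (r - h) = a * h + -a * r by ring, Real.exp_add, mul_sub, Real.cos_sub]
  ring

lemma group_apply_sinTransform (hW : IsStronglyContinuousGroup W) (hb : HasGrowthBound W M ω) {a : ℝ}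
    (ha : ω < a) (b : ℝ) (v : V) (h : ℝ) : W h (sinTransform W a b v) =
    (Real.exp (a * h) * Real.cos (b * h)) •
      (sinTransform W a b v - ∫ r in (0 : ℝ)..h, (Real.exp (-a * r) * Real.sin (b * r)) • W r v) -
    (Real.exp (a * h) * Real.sin (b * h)) •
      (cosTransform W a b v -
        ∫ r in (0 : ℝ)..h, (Real.exp (-a * r) * Real.cos (b * r)) • W r v) := by
  obtain ⟨hc, hc'⟩ := integral_Ioi_eq_sub hW v (k := fun r => Real.exp (-a * r) * Real.cos (b * r))
    (by fun_prop) (integrableOn_cos hW hb ha b v) h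
  obtain ⟨hs, hs'⟩ := integral_Ioi_eq_sub hW v (k := fun r => Real.exp (-a * r) * Real.sin (b * r))
    (by fun_prop) (integrableOn_sin hW hb ha b v) h
  unfold cosTransform sinTransform
  rw [group_apply_integral hW hb ha (by fun_prop) (fun r _ => abs_exp_mul_sin_le a b r) v h,
    ← hc', ← hs', ← integral_smul, ← integral_smul]
  refine Eq.trans ?_ (integral_sub (hs.smul _) (hc.smul _))
  refine integral_congr_ae (ae_of_all _ fun r => ?_)
  simp only [smul_smul, ← sub_smul]
  congr 1
  rw [show -a * (r - h) = a * h + -a * r by ring, Real.exp_add, mul_sub, Real.sin_sub]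
  ring

lemma hasDerivAt_exp_mul_cos (a b : ℝ) :
    HasDerivAt (fun h : ℝ => Real.exp (a * h) * Real.cos (b * h)) a 0 := by
  have h1 := ((hasDerivAt_id (0 : ℝ)).const_mul a).exp.mul ((hasDerivAt_id (0 : ℝ)).const_mul b).cos
  exact h1.congr_deriv (by simp)

lemma hasDerivAt_exp_mul_sin (a b : ℝ) :
    HasDerivAt (fun h : ℝ => Real.exp (a * h) * Real.sin (b * h)) b 0 := by
  have h1 := ((hasDerivAt_id (0 : ℝ)).const_mul a).exp.mul ((hasDerivAt_id (0 : ℝ)).const_mul b).sin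
  exact h1.congr_deriv (by simp)

lemma hasDerivAt_group_cosTransform (hW : IsStronglyContinuousGroup W) (hb : HasGrowthBound W M ω) {a : ℝ}
    (ha : ω < a) (b : ℝ) (v : V) : HasDerivAt (fun t => W t (cosTransform W a b v))
    (a • cosTransform W a b v + b • sinTransform W a b v - v) 0 := by
  have h1 := hasDerivAt_integral_smul_group hW v
    (k := fun r => Real.exp (-a * r) * Real.cos (b * r)) (by fun_prop)
  have h2 := hasDerivAt_integral_smul_group hW v
    (k := fun r => Real.exp (-a * r) * Real.sin (b * r)) (by fun_prop)
  have h3 := ((hasDerivAt_exp_mul_cos a b).smul (h1.const_sub (cosTransform W a b v))).add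
    ((hasDerivAt_exp_mul_sin a b).smul (h2.const_sub (sinTransform W a b v)))
  refine (h3.congr_of_eventuallyEq (Eventually.of_forall fun h =>
    group_apply_cosTransform hW hb ha b v h)).congr_deriv ?_
  simp
  abel

lemma hasDerivAt_group_sinTransform (hW : IsStronglyContinuousGroup W) (hb : HasGrowthBound W M ω) {a : ℝ}
    (ha : ω < a) (b : ℝ) (v : V) : HasDerivAt (fun t => W t (sinTransform W a b v))
    (a • sinTransform W a b v - b • cosTransform W a b v) 0 := by
  have h1 := hasDerivAt_integral_smul_group hW v
    (k := fun r => Real.exp (-a * r) * Real.cos (b * r)) (by fun_prop)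
  have h2 := hasDerivAt_integral_smul_group hW v
    (k := fun r => Real.exp (-a * r) * Real.sin (b * r)) (by fun_prop)
  have h3 := ((hasDerivAt_exp_mul_cos a b).smul (h2.const_sub (sinTransform W a b v))).sub
    ((hasDerivAt_exp_mul_sin a b).smul (h1.const_sub (cosTransform W a b v)))
  refine (h3.congr_of_eventuallyEq (Eventually.of_forall fun h =>
    group_apply_sinTransform hW hb ha b v h)).congr_deriv ?_
  simp

/-- Bounded operators `Q` and `C` that commute with the group and give, along the group, the
inverse of `(A - a)² + b²` for the generator `A`, together with `C = (a - A) Q`. -/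
lemma exists_quadratic_inverse (hW : IsStronglyContinuousGroup W) (hb : HasGrowthBound W M ω) {a : ℝ}
    (ha : ω < a) (b : ℝ) : ∃ Q C : V →L[ℍ[ℝ]ᵐᵒᵖ] V,
    (∀ t v, Q (W t v) = W t (Q v)) ∧
    (∀ v, C v = cosTransform W a b v) ∧ (∀ v, b • Q v = sinTransform W a b v) ∧
    (∀ v, HasDerivAt (fun t => W t (Q v)) (a • Q v - C v) 0) ∧
    ∀ v, HasDerivAt (fun t => W t (C v)) (a • C v + (b ^ 2) • Q v - v) 0 := by
  obtain ⟨C, hC, hCc⟩ := exists_kernel_operator hW hb ha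
    (k := fun r => Real.exp (-a * r) * Real.cos (b * r)) (by fun_prop)
    (fun r _ => abs_exp_mul_cos_le a b r)
  replace hC : ∀ v, C v = cosTransform W a b v := hC
  rcases eq_or_ne b 0 with rfl | hb0
  -- For b = 0 the quotient of the sine transform by b is meaningless; there `C` is the ordinary
  -- resolvent at a and its square inverts (A - a)².
  · refine ⟨C.comp C, C, ?_, hC, ?_, ?_, ?_⟩
    · intro t v; simp [hCc]
    · intro v; simp [sinTransform]
    · intro v
      have h := hasDerivAt_group_cosTransform hW hb ha 0 (C v)
      simpa [← hC] using h
    · intro v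
      have h := hasDerivAt_group_cosTransform hW hb ha 0 v
      simpa [← hC] using h
  · obtain ⟨Q, hQ, hQc⟩ := exists_kernel_operator hW hb ha
      (k := fun r => b⁻¹ * (Real.exp (-a * r) * Real.sin (b * r))) (C := |b⁻¹|) (by fun_prop)
      (fun r _ => by
        rw [abs_mul]
        exact mul_le_mul_of_nonneg_left (by simpa using abs_exp_mul_sin_le a b r) (abs_nonneg _))
    have hQ' : ∀ v, Q v = b⁻¹ • sinTransform W a b v := fun v => by
      rw [hQ, sinTransform, ← integral_smul]
      simp only [smul_smul]
    have hQ'' : ∀ v, b • Q v = sinTransform W a b v := fun v => by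
      rw [hQ', smul_smul, mul_inv_cancel₀ hb0, one_smul]
    refine ⟨Q, C, hQc, hC, hQ'', ?_, ?_⟩
    · intro v
      have h := (hasDerivAt_group_sinTransform hW hb ha b v).const_smul b⁻¹
      refine (h.congr_of_eventuallyEq (Eventually.of_forall fun t => ?_)).congr_deriv ?_
      · have h2 := ((W t).restrictScalars ℝ).map_smul b⁻¹ (sinTransform W a b v)
        simp only [ContinuousLinearMap.coe_restrictScalars'] at h2
        simp only [hQ', h2, Pi.smul_apply]
      · rw [smul_sub, smul_smul b⁻¹ b, inv_mul_cancel₀ hb0, one_smul, hC, hQ', smul_comm]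
    · intro v
      have h := hasDerivAt_group_cosTransform hW hb ha b v
      rw [← hC, ← hQ''] at h
      simpa [smul_smul, pow_two] using h

lemma abs_mul_exp_le {β γ r : ℝ} (h : γ < β) (hr : 0 < r) :
    |r * Real.exp (-β * r)| ≤ (β - γ)⁻¹ * Real.exp (-γ * r) := by
  rw [abs_of_pos (by positivity)]
  have h1 : (β - γ) * r ≤ Real.exp ((β - γ) * r) :=
    (Real.add_one_le_exp _).trans' (by linarith)
  rw [le_inv_mul_iff₀ (sub_pos.2 h), ← mul_assoc]
  calc _ ≤ Real.exp ((β - γ) * r) * Real.exp (-β * r) := by gcongr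
    _ = _ := by rw [← Real.exp_add]; congr 1; ring

/-- Recovering `u` from `(β - A)² u`, where `A` is the generator. -/
lemma integral_mul_exp_smul_group (hW : IsStronglyContinuousGroup W) (hb : HasGrowthBound W M ω)
    {β : ℝ} (hβ : ω < β) {u u' w : V} (hu : HasDerivAt (fun t => W t u) (β • u - u') 0)
    (hu' : HasDerivAt (fun t => W t u') (β • u' - w) 0) :
    IntegrableOn (fun r => (r * Real.exp (-β * r)) • W r w) (Set.Ioi 0) ∧
    ∫ r in Set.Ioi 0, (r * Real.exp (-β * r)) • W r w = u := by
  -- The room between γ and β absorbs the polynomial factor r.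
  obtain ⟨γ, hγ1, hγ2⟩ := exists_between hβ
  have hk : ∀ r, 0 < r → |r * Real.exp (-β * r)| ≤ (β - γ)⁻¹ * Real.exp (-γ * r) :=
    fun r hr => abs_mul_exp_le hγ2 hr
  have hi := integrableOn_smul_group hW hb hγ1 (k := fun r => r * Real.exp (-β * r))
    (by fun_prop) hk w
  refine ⟨hi, ?_⟩
  have hexp : ∀ r : ℝ, HasDerivAt (fun r => Real.exp (-β * r)) (Real.exp (-β * r) * (-β)) r :=
    fun r => by simpa using ((hasDerivAt_id r).const_mul (-β)).exp
  -- An explicit antiderivative, from two integrations by parts with u' = (β - A)u and w = (β -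
  -- A)u'. It equals -u at 0 and vanishes at infinity.
  have hD : ∀ r : ℝ, HasDerivAt (fun r => -((r * Real.exp (-β * r)) • W r u' +
      Real.exp (-β * r) • W r u)) ((r * Real.exp (-β * r)) • W r w) r := by
    intro r
    have h1 := (((hasDerivAt_id r).mul (hexp r)).smul (hW.hasDerivAt hu' r)).add
      ((hexp r).smul (hW.hasDerivAt hu r))
    refine h1.neg.congr_deriv ?_
    have e1 := ((W r).restrictScalars ℝ).map_smul β u
    have e2 := ((W r).restrictScalars ℝ).map_smul β u'
    simp only [ContinuousLinearMap.coe_restrictScalars'] at e1 e2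
    simp only [map_sub, e1, e2, id, Pi.mul_apply]
    module
  have hlim : Tendsto (fun r => -((r * Real.exp (-β * r)) • W r u' +
      Real.exp (-β * r) • W r u)) atTop (𝓝 0) := by
    have hz : ∀ C : ℝ, Tendsto (fun r => C * Real.exp (-(γ - ω) * r)) atTop (𝓝 0) := fun C => by
      have h1 : Tendsto (fun r : ℝ => -(γ - ω) * r) atTop atBot :=
        tendsto_id.const_mul_atTop_of_neg (by linarith)
      simpa using (Real.tendsto_exp_atBot.comp h1).const_mul C
    have h1 : Tendsto (fun r => (r * Real.exp (-β * r)) • W r u') atTop (𝓝 0) :=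
      squeeze_zero_norm' ((eventually_gt_atTop 0).mono fun r hr =>
        norm_smul_group_le (k := fun r => r * Real.exp (-β * r)) hb hk u' hr) (hz _)
    have h2 : Tendsto (fun r => (Real.exp (-β * r)) • W r u) atTop (𝓝 0) :=
      squeeze_zero_norm' ((eventually_gt_atTop 0).mono fun r hr =>
        norm_smul_group_le (k := fun r => Real.exp (-β * r)) (C := 1) (a := γ) hb
          (fun r hr => by
            rw [Real.abs_exp, one_mul]
            exact Real.exp_le_exp.2 (by nlinarith)) u hr) (hz _)
    simpa using (h1.add h2).neg
  have h := integral_Ioi_of_hasDerivAt_of_tendsto (a := 0)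
    (hD 0).continuousAt.continuousWithinAt (fun r _ => hD r) hi hlim
  rw [h]
  simp [hW.zero]

end Group

/-! ### The complex plane `ℂ_I` -/

section Slice

variable {I : ℍ[ℝ]}

lemma star_of_mem_imagUnits (hI : I ∈ imagUnits) : star I = -I :=
  Quaternion.star_eq_neg.2 hI.1

lemma mul_self_of_mem_imagUnits (hI : I ∈ imagUnits) : I * I = -1 := by
  have h := Quaternion.self_mul_star I
  rw [star_of_mem_imagUnits hI, Quaternion.normSq_eq_norm_mul_self, hI.2] at h
  rw [mul_neg] at h
  simpa using congrArg Neg.neg h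

/-- The embedding `x + iy ↦ x + Iy` of `ℂ` into `ℍ` with image `ℂ_I`. -/
noncomputable def sliceEmbedding (hI : I ∈ imagUnits) : ℂ →ₐ[ℝ] ℍ[ℝ] :=
  Complex.liftAux I (mul_self_of_mem_imagUnits hI)

lemma sliceEmbedding_apply (hI : I ∈ imagUnits) (z : ℂ) :
    sliceEmbedding hI z = (z.re : ℍ[ℝ]) + z.im • I := rfl

lemma star_sliceEmbedding (hI : I ∈ imagUnits) (z : ℂ) :
    star (sliceEmbedding hI z) = sliceEmbedding hI (starRingEnd ℂ z) := by
  simp [sliceEmbedding_apply, star_of_mem_imagUnits hI]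

lemma norm_sliceEmbedding (hI : I ∈ imagUnits) (z : ℂ) : ‖sliceEmbedding hI z‖ = ‖z‖ := by
  have h := Quaternion.self_mul_star (sliceEmbedding hI z)
  rw [star_sliceEmbedding, ← map_mul, Complex.mul_conj, Quaternion.normSq_eq_norm_mul_self,
    Complex.normSq_eq_norm_sq, sliceEmbedding_apply] at h
  simp only [Complex.ofReal_re, Complex.ofReal_im, zero_smul, add_zero] at h
  have h' : ‖z‖ ^ 2 = ‖sliceEmbedding hI z‖ * ‖sliceEmbedding hI z‖ := Quaternion.coe_injective h
  rw [← sq_eq_sq₀ (norm_nonneg _) (norm_nonneg _), h', pow_two]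

lemma continuous_sliceEmbedding (hI : I ∈ imagUnits) : Continuous (sliceEmbedding hI) := by
  simp only [funext (sliceEmbedding_apply hI)]
  have h1 : Continuous fun x : ℝ => (x : ℍ[ℝ]) := Quaternion.continuous_coe
  fun_prop

lemma exp_sliceEmbedding (hI : I ∈ imagUnits) (z : ℂ) :
    NormedSpace.exp (sliceEmbedding hI z) = sliceEmbedding hI (Complex.exp z) := by
  rw [Complex.exp_eq_exp_ℂ]
  exact (NormedSpace.map_exp (sliceEmbedding hI) (continuous_sliceEmbedding hI) z).symm

lemma rightLine_eq (hI : I ∈ imagUnits) (c τ : ℝ) :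
    rightLine c I τ = sliceEmbedding hI (c + τ * Complex.I) := by
  simp [rightLine, sliceEmbedding_apply]

lemma leftLine_eq (c τ : ℝ) : leftLine c I τ = (-1 : ℝ) • rightLine c I τ := by
  simp [leftLine, rightLine]; abel

lemma exp_neg_smul_rightLine (hI : I ∈ imagUnits) (a b r : ℝ) :
    NormedSpace.exp (-(r • rightLine a I b)) =
      ((Real.exp (-a * r) * Real.cos (b * r) : ℝ) : ℍ[ℝ]) -
        (Real.exp (-a * r) * Real.sin (b * r)) • I := by
  rw [rightLine_eq hI, ← map_smul, ← map_neg, exp_sliceEmbedding, sliceEmbedding_apply,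
    Complex.exp_re, Complex.exp_im]
  have h1 : (-(r • ((a : ℂ) + b * Complex.I))).re = -a * r := by simp; ring
  have h2 : (-(r • ((a : ℂ) + b * Complex.I))).im = -(b * r) := by simp; ring
  rw [h1, h2]
  simp [sub_eq_add_neg]

end Slice

/-! ### The right `S`-resolvent of a generator -/

section Resolvent

set_option linter.unusedSectionVars false

variable {V : Type*} [NormedAddCommGroup V] [NormedSpace ℝ V]
  [Module ℍ[ℝ] V] [IsBoundedSMul ℍ[ℝ] V] [IsScalarTower ℝ ℍ[ℝ] V]
  [Module ℍ[ℝ]ᵐᵒᵖ V] [IsBoundedSMul ℍ[ℝ]ᵐᵒᵖ V] [IsScalarTower ℝ ℍ[ℝ]ᵐᵒᵖ V]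
  {U : ℝ → V →L[ℍ[ℝ]ᵐᵒᵖ] V} {M ω σ : ℝ} {T : V →ₗ.[ℍ[ℝ]ᵐᵒᵖ] V}

lemma coe_smul_eq (a : ℝ) (v : V) : (a : ℍ[ℝ]) • v = a • v := by
  rw [← algebraMap_smul ℍ[ℝ] a v]; rfl

lemma hasDerivAt_comp_mul {v w : V} (h : HasDerivAt (fun t => U t v) w 0) (σ : ℝ) :
    HasDerivAt (fun t => U (σ * t) v) (σ • w) 0 := by
  have h1 : HasDerivAt (fun t : ℝ => σ * t) σ 0 := by
    simpa using (hasDerivAt_id (0 : ℝ)).const_mul σ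
  have h2 : HasDerivAt (fun t => U t v) w (σ * 0) := by simpa using h
  exact h2.scomp 0 h1

lemma IsGenerator.exists_of_hasDerivAt_comp_mul (hT : IsGenerator U T)
    (hU : IsStronglyContinuousGroup U) (hσ : σ * σ = 1) {v w : V}
    (h : HasDerivAt (fun t => U (σ * t) v) w 0) :
    ∃ hv : v ∈ T.domain, T ⟨v, hv⟩ = σ • w := by
  refine hT.exists_of_hasDerivAt hU ?_
  have := hasDerivAt_comp_mul (U := fun t => U (σ * t)) h σ
  simpa [← mul_assoc, hσ] using this

lemma rightSResolvent_eq {s : ℍ[ℝ]} {Q : V →L[ℍ[ℝ]ᵐᵒᵖ] V} (hQ : IsPseudoResolvent T s Q) (v : V) :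
    rightSResolvent T s v = -(T ⟨Q v, (hQ.1 v).1.1⟩ - star s • Q v) := by
  have h : s ∈ sResolventSet T := ⟨Q, hQ⟩
  -- The chosen inverse is the given one: apply it, as a left inverse, to the element `Q v` whose
  -- image is `v`.
  have hc : h.choose v = Q v := by
    obtain ⟨hd, he⟩ := hQ.1 v
    have := h.choose_spec.2 ⟨Q v, hd⟩
    rwa [he] at this
  unfold rightSResolvent
  rw [dif_pos h]
  simp only [hc]

variable [CompleteSpace V]

/-- The generator of t ↦ U(σt) is A = σT, and σ² = 1 gives T² - 2 Re(s) T + |s|² = (A - a)² + b².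
The hypotheses on `Q` and `C` say AQ = aQ - C and AC = aC + b²Q - 1, which makes `Q` a right
inverse. -/
lemma isPseudoResolvent_of_quadratic_inverse (hU : IsStronglyContinuousGroup U)
    (hb : HasGrowthBound U M ω) (hT : IsGenerator U T) (hσ : σ * σ = 1) {a b : ℝ}
    {s : ℍ[ℝ]} (hre : s.re = σ * a) (hnorm : ‖s‖ ^ 2 = a ^ 2 + b ^ 2)
    {Q C : V →L[ℍ[ℝ]ᵐᵒᵖ] V} (hQc : ∀ t v, Q (U (σ * t) v) = U (σ * t) (Q v))
    (hQ : ∀ v, HasDerivAt (fun t => U (σ * t) (Q v)) (a • Q v - C v) 0)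
    (hC : ∀ v, HasDerivAt (fun t => U (σ * t) (C v)) (a • C v + (b ^ 2) • Q v - v) 0) :
    IsPseudoResolvent T s Q := by
  have hσ' : ∀ x : V, σ • σ • x = x := fun x => by rw [smul_smul, hσ, one_smul]
  have hreal : ∀ (L : V →L[ℍ[ℝ]ᵐᵒᵖ] V) (r : ℝ) (x : V), L (r • x) = r • L x := fun L r x =>
    (L.restrictScalars ℝ).map_smul r x
  constructor
  · intro v
    obtain ⟨h1, e1⟩ := hT.exists_of_hasDerivAt_comp_mul hU hσ (hQ v)
    have h2 : HasDerivAt (fun t => U (σ * t) (σ • (a • Q v - C v)))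
        (σ • (a • (a • Q v - C v) - (a • C v + (b ^ 2) • Q v - v))) 0 := by
      have := (((hQ v).const_smul a).sub (hC v)).const_smul σ
      refine this.congr_of_eventuallyEq (Eventually.of_forall fun t => ?_)
      simp [hreal]
    obtain ⟨h3, e3⟩ := hT.exists_of_hasDerivAt_comp_mul hU hσ h2
    have hd : Q v ∈ domSq T := ⟨h1, by rw [e1]; exact h3⟩
    refine ⟨hd, ?_⟩
    unfold pseudoResolventMap
    simp only [e1, e3, hσ', hre, hnorm]
    rw [show 2 * (σ * a) = (2 * a) * σ by ring, mul_smul _ σ, hσ']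
    module
  -- For the left inverse, `Q` commutes with the group, so differentiating Q U(σt)u at 0 gives QA =
  -- AQ on the domain.
  · intro u
    obtain ⟨u, h1, h2⟩ := u
    have d1 := hasDerivAt_comp_mul (hT.hasDerivAt hU hb ⟨u, h1⟩) σ
    have d2 := hasDerivAt_comp_mul (hT.hasDerivAt hU hb ⟨_, h2⟩) σ
    simp only [pseudoResolventMap]
    set u1 := T ⟨u, h1⟩ with hu1
    set u2 := T ⟨u1, h2⟩ with hu2
    simp only at d1 d2
    have c1 : HasDerivAt (fun t => U (σ * t) (Q u)) (Q (σ • u1)) 0 := by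
      have := (Q.restrictScalars ℝ).hasFDerivAt.comp_hasDerivAt 0 d1
      exact this.congr_of_eventuallyEq (Eventually.of_forall fun t => (hQc t u).symm)
    have c2 : HasDerivAt (fun t => U (σ * t) (Q u1)) (Q (σ • u2)) 0 := by
      have := (Q.restrictScalars ℝ).hasFDerivAt.comp_hasDerivAt 0 d2
      exact this.congr_of_eventuallyEq (Eventually.of_forall fun t => (hQc t u1).symm)
    have e1 : C u = a • Q u - σ • Q u1 := by
      have := c1.unique (hQ u)
      rw [← hreal Q σ u1, this]; abel
    have c3 : HasDerivAt (fun t => U (σ * t) (C u)) (a • (a • Q u - C u) - σ • Q (σ • u2)) 0 := by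
      have := ((hQ u).const_smul a).sub (c2.const_smul σ)
      refine this.congr_of_eventuallyEq (Eventually.of_forall fun t => ?_)
      simp [hreal, e1]
    have e2 := c3.unique (hC u)
    rw [hreal, hσ', e1] at e2
    have e3 : u = Q u2 - (2 * (σ * a)) • Q u1 + (a ^ 2 + b ^ 2) • Q u := by
      have : u = a • (a • Q u - σ • Q u1) + b ^ 2 • Q u -
        (a • (a • Q u - (a • Q u - σ • Q u1)) - Q u2) := by rw [e2]; abel
      refine this.trans ?_
      module
    rw [map_add, map_sub, hreal, hreal, hre, hnorm]
    exact e3.symm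

/-- With s = σ(a + Ib) and TQ = σ(aQ - C), the terms aQ cancel in -(T - s̄)Q and leave σ(C - I bQ).
As C and bQ are the cosine and sine transforms, this is the Laplace integral with kernel e^{-ar}(cos
br - I sin br) = e^{-(a+Ib)r}. -/
lemma smul_rightLine_mem_and_eq (hU : IsStronglyContinuousGroup U)
    (hb : HasGrowthBound U M ω) (hT : IsGenerator U T) (hσ : σ * σ = 1) {a : ℝ} (ha : ω < a)
    (b : ℝ) {I : ℍ[ℝ]} (hI : I ∈ imagUnits) :
    σ • rightLine a I b ∈ sResolventSet T ∧ ∀ v, rightSResolvent T (σ • rightLine a I b) v =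
      σ • ∫ r in Set.Ioi 0, NormedSpace.exp (-(r • rightLine a I b)) • U (σ * r) v := by
  have hσa : |σ| = 1 := by
    rcases mul_self_eq_one_iff.1 hσ with h | h <;> simp [h]
  have hW := hU.comp_mul σ
  have hbW := hb.comp_mul hσa
  obtain ⟨Q, C, hQc, hCe, hQe, hQ, hC⟩ := exists_quadratic_inverse hW hbW ha b
  have hre : (σ • rightLine a I b).re = σ * a := by
    simp [rightLine, hI.1]
  have hnorm : ‖σ • rightLine a I b‖ ^ 2 = a ^ 2 + b ^ 2 := by
    rw [norm_smul, Real.norm_eq_abs, hσa, one_mul, rightLine_eq hI, norm_sliceEmbedding,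
      ← Complex.normSq_eq_norm_sq, Complex.normSq_add_mul_I]
  have hP := isPseudoResolvent_of_quadratic_inverse hU hb hT hσ hre hnorm hQc hQ hC
  refine ⟨⟨Q, hP⟩, fun v => ?_⟩
  obtain ⟨h1, e1⟩ := hT.exists_of_hasDerivAt_comp_mul hU hσ (hQ v)
  rw [rightSResolvent_eq hP, e1]
  have hstar : star (σ • rightLine a I b) • Q v = σ • (a • Q v - I • (b • Q v)) := by
    have : star (σ • rightLine a I b) = σ • ((a : ℍ[ℝ]) - b • I) := by
      simp [rightLine, star_of_mem_imagUnits hI, sub_eq_add_neg]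
    rw [this, smul_assoc, sub_smul, coe_smul_eq, smul_assoc, smul_comm I b]
  have hc := integrableOn_cos hW hbW ha b v
  have hs := integrableOn_sin hW hbW ha b v
  have hint : ∫ r in Set.Ioi 0, NormedSpace.exp (-(r • rightLine a I b)) • U (σ * r) v =
      C v - I • (b • Q v) := by
    rw [hCe, hQe, cosTransform, sinTransform, ← Integrable.integral_smul I hs]
    refine Eq.trans ?_ (integral_sub hc (hs.smul I))
    refine integral_congr_ae (ae_of_all _ fun r => ?_)
    simp only [exp_neg_smul_rightLine hI, sub_smul, coe_smul_eq, smul_assoc, smul_comm I]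
  rw [hint, hstar, ← smul_sub, ← smul_neg]
  congr 1
  abel

end Resolvent

/-! ### A bilateral Laplace inversion -/

section Fourier

lemma integral_mul_cexp_Ioi {w : ℂ} (hw : 0 < w.re) :
    IntegrableOn (fun x : ℝ => (x : ℂ) * Complex.exp (-w * x)) (Set.Ioi 0) ∧
    ∫ x : ℝ in Set.Ioi 0, (x : ℂ) * Complex.exp (-w * x) = (w ^ 2)⁻¹ := by
  have hw0 : w ≠ 0 := fun h => by simp [h] at hw
  have hnorm : ∀ x : ℝ, ‖Complex.exp (-w * x)‖ = Real.exp (-w.re * x) := fun x => by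
    simp [Complex.norm_exp]
  have hle : ∀ x : ℝ, 0 < x → ‖(x : ℂ) * Complex.exp (-w * x)‖ ≤
      (w.re - w.re / 2)⁻¹ * Real.exp (-(w.re / 2) * x) := fun x hx => by
    rw [norm_mul, hnorm, Complex.norm_real, Real.norm_eq_abs, ← Real.abs_exp, ← abs_mul]
    exact abs_mul_exp_le (by linarith) hx
  have hi : IntegrableOn (fun x : ℝ => (x : ℂ) * Complex.exp (-w * x)) (Set.Ioi 0) :=
    integrableOn_Ioi_of_norm_le_exp (half_pos hw) (by fun_prop) hle
  refine ⟨hi, ?_⟩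
  have hD : ∀ x : ℝ, HasDerivAt (fun x : ℝ => -(w⁻¹ * (x * Complex.exp (-w * x)) +
      (w ^ 2)⁻¹ * Complex.exp (-w * x))) ((x : ℂ) * Complex.exp (-w * x)) x := by
    intro x
    have h1 : HasDerivAt (fun x : ℝ => (x : ℂ)) 1 x := (hasDerivAt_id x).ofReal_comp
    have h2 := (h1.const_mul (-w)).cexp
    have h3 := (((h1.mul h2).const_mul w⁻¹).add (h2.const_mul (w ^ 2)⁻¹)).neg
    refine h3.congr_deriv ?_
    field_simp
    ring
  have hz : ∀ C b : ℝ, 0 < b → Tendsto (fun r => C * Real.exp (-b * r)) atTop (𝓝 0) :=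
    fun C b hb => by
      have h1 : Tendsto (fun r : ℝ => -b * r) atTop atBot :=
        tendsto_id.const_mul_atTop_of_neg (by linarith)
      simpa using (Real.tendsto_exp_atBot.comp h1).const_mul C
  have l1 : Tendsto (fun x : ℝ => (x : ℂ) * Complex.exp (-w * x)) atTop (𝓝 0) :=
    squeeze_zero_norm' ((eventually_gt_atTop 0).mono hle) (hz _ _ (half_pos hw))
  have l2 : Tendsto (fun x : ℝ => Complex.exp (-w * x)) atTop (𝓝 0) :=
    squeeze_zero_norm (fun x => (hnorm x).le) (by simpa using hz 1 _ hw)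
  have l3 : Tendsto (fun x : ℝ => -(w⁻¹ * (x * Complex.exp (-w * x)) +
      (w ^ 2)⁻¹ * Complex.exp (-w * x))) atTop (𝓝 0) := by
    simpa using ((l1.const_mul w⁻¹).add (l2.const_mul (w ^ 2)⁻¹)).neg
  have h := integral_Ioi_of_hasDerivAt_of_tendsto (a := 0)
    (hD 0).continuousAt.continuousWithinAt (fun r _ => hD r) hi l3
  rw [h]
  simp

lemma norm_add_mul_I_sq_inv (p τ : ℝ) :
    ‖(((p : ℂ) + τ * Complex.I) ^ 2)⁻¹‖ = (p ^ 2 + τ ^ 2)⁻¹ := by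
  rw [norm_inv, norm_pow, ← Complex.normSq_eq_norm_sq, Complex.normSq_add_mul_I]

lemma integrable_add_mul_I_sq_inv {p : ℝ} (hp : p ≠ 0) :
    Integrable fun τ : ℝ => (((p : ℂ) + τ * Complex.I) ^ 2)⁻¹ := by
  have hne : ∀ τ : ℝ, ((p : ℂ) + τ * Complex.I) ^ 2 ≠ 0 := fun τ h => by
    have := congrArg Complex.re (pow_eq_zero_iff (two_ne_zero) |>.1 h)
    simp [hp] at this
  refine Integrable.mono' (integrable_inv_one_add_sq.const_mul (1 + (p ^ 2)⁻¹))
    (Continuous.aestronglyMeasurable (Continuous.inv₀ (by fun_prop) hne)) (ae_of_all _ fun τ => ?_)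
  rw [norm_add_mul_I_sq_inv]
  have hp2 : 0 < p ^ 2 := by positivity
  have h1 : 1 + τ ^ 2 ≤ (1 + (p ^ 2)⁻¹) * (p ^ 2 + τ ^ 2) := by
    have h2 : (1 + (p ^ 2)⁻¹) * (p ^ 2 + τ ^ 2) = 1 + τ ^ 2 + (p ^ 2 + (p ^ 2)⁻¹ * τ ^ 2) := by
      field_simp; ring
    rw [h2]
    have : 0 ≤ p ^ 2 + (p ^ 2)⁻¹ * τ ^ 2 := by positivity
    linarith
  rw [inv_le_iff_one_le_mul₀ (by positivity), mul_right_comm,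
    ← div_eq_mul_inv, one_le_div (by positivity)]
  exact h1

/-- Fourier inversion for `max x 0 * e^{-px}`. -/
lemma fourier_max_mul_exp {p : ℝ} (hp : 0 < p) (x : ℝ) :
    ∫ ξ : ℝ, Complex.exp ((2 * Real.pi * ξ * x : ℝ) * Complex.I) *
      (((p : ℂ) + (2 * Real.pi * ξ : ℝ) * Complex.I) ^ 2)⁻¹ =
    ((max x 0 * Real.exp (-p * x) : ℝ) : ℂ) := by
  let h : ℝ → ℂ := fun x => ((max x 0 * Real.exp (-p * x) : ℝ) : ℂ)
  -- The double pole matters here: the function is continuous at 0 and its transform decays like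
  -- |ξ|^{-2}, so Fourier inversion holds at every point.
  have hcont : Continuous h := by fun_prop
  have hind : ∀ (ξ : ℝ), (fun x : ℝ => Complex.exp ((-2 * Real.pi * x * ξ : ℝ) * Complex.I) • h x) =
      (Set.Ioi 0).indicator fun x : ℝ =>
        (x : ℂ) * Complex.exp (-((p : ℂ) + (2 * Real.pi * ξ : ℝ) * Complex.I) * x) := by
    intro ξ
    ext x
    rcases le_or_gt x 0 with hx | hx
    · simp [h, max_eq_right hx, Set.indicator_of_notMem (show x ∉ Set.Ioi 0 by simpa using hx)]
    · rw [Set.indicator_of_mem (show x ∈ Set.Ioi 0 from hx)]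
      simp only [h, max_eq_left hx.le, smul_eq_mul, Complex.ofReal_mul, Complex.ofReal_exp]
      rw [mul_left_comm, ← Complex.exp_add]
      congr 2
      push_cast; ring
  have hre : ∀ ξ : ℝ, 0 < ((p : ℂ) + (2 * Real.pi * ξ : ℝ) * Complex.I).re := fun ξ => by
    simpa using hp
  have hint : Integrable h := by
    have h1 := (integral_mul_cexp_Ioi (hre 0)).1.integrable_indicator measurableSet_Ioi
    rw [← hind 0] at h1
    simpa using h1
  have hF : FourierTransform.fourier h = fun ξ : ℝ =>
      (((p : ℂ) + (2 * Real.pi * ξ : ℝ) * Complex.I) ^ 2)⁻¹ := by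
    ext ξ
    rw [Real.fourier_real_eq_integral_exp_smul, hind, integral_indicator measurableSet_Ioi,
      (integral_mul_cexp_Ioi (hre ξ)).2]
  have hFi : Integrable (FourierTransform.fourier h) := by
    rw [hF]
    exact (integrable_add_mul_I_sq_inv hp.ne').comp_mul_left' (R := 2 * Real.pi) (by positivity)
  have := congrFun (hcont.fourierInv_fourier_eq hint hFi) x
  rw [Real.fourierInv_eq', hF] at this
  refine Eq.trans ?_ this
  refine integral_congr_ae (ae_of_all _ fun ξ => ?_)
  simp only [smul_eq_mul]
  congr 4
  simp
  ring

/-- `∫ e^{-x(c+iτ)} (α - c - iτ)^{-2} dτ` for `c < α`. -/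
lemma integral_cexp_mul_inv_sq_of_lt {c α : ℝ} (h : c < α) (x : ℝ) :
    ∫ τ : ℝ, Complex.exp (-(x * (c + τ * Complex.I))) *
      (((α : ℂ) - (c + τ * Complex.I)) ^ 2)⁻¹ =
    ((2 * Real.pi * (max x 0 * Real.exp (-α * x)) : ℝ) : ℂ) := by
  -- The substitution τ = -2πξ matches the Fourier normalisation and turns α - c - iτ into p + 2πiξ
  -- with p = α - c > 0.
  have h1 := Measure.integral_comp_mul_left (fun τ : ℝ => Complex.exp (-(x * (c + τ * Complex.I))) *
      (((α : ℂ) - (c + τ * Complex.I)) ^ 2)⁻¹) (-(2 * Real.pi))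
  have h2 : ∀ ξ : ℝ, Complex.exp (-(x * (c + (-(2 * Real.pi) * ξ : ℝ) * Complex.I))) *
      (((α : ℂ) - (c + (-(2 * Real.pi) * ξ : ℝ) * Complex.I)) ^ 2)⁻¹ =
      (Real.exp (-(c * x)) : ℂ) * (Complex.exp ((2 * Real.pi * ξ * x : ℝ) * Complex.I) *
      (((α - c : ℝ) + (2 * Real.pi * ξ : ℝ) * Complex.I) ^ 2)⁻¹) := by
    intro ξ
    rw [Complex.ofReal_exp, ← mul_assoc, ← Complex.exp_add]
    congr 2
    · push_cast; ring
    · push_cast; ring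
  simp_rw [h2] at h1
  rw [integral_const_mul, fourier_max_mul_exp (sub_pos.2 h)] at h1
  have hpi : |(-(2 * Real.pi))⁻¹| = (2 * Real.pi)⁻¹ := by
    rw [abs_inv, abs_neg, abs_of_pos Real.two_pi_pos]
  rw [hpi, eq_comm, inv_smul_eq_iff₀ Real.two_pi_pos.ne'] at h1
  rw [h1, Complex.real_smul, ← Complex.ofReal_mul, ← Complex.ofReal_mul]
  congr 2
  rw [mul_left_comm, ← Real.exp_add]
  congr 2
  ring

/-- `∫ e^{-x(c+iτ)} (α - c - iτ)^{-2} dτ` for `α = εβ`, `ε = ± 1` and `εc < β`. -/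
lemma integral_cexp_mul_inv_sq {ε c β : ℝ} (hε : ε * ε = 1) (h : ε * c < β) (x : ℝ) :
    ∫ τ : ℝ, Complex.exp (-(x * (c + τ * Complex.I))) *
      ((((ε * β : ℝ) : ℂ) - (c + τ * Complex.I)) ^ 2)⁻¹ =
    ((2 * Real.pi * (max (ε * x) 0 * Real.exp (-β * (ε * x))) : ℝ) : ℂ) := by
  rcases mul_self_eq_one_iff.1 hε with rfl | rfl
  · simpa using integral_cexp_mul_inv_sq_of_lt (by simpa using h) x
  -- The reflection τ ↦ -τ reduces a pole on the left to the previous case with (x, c) replaced by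
  -- (-x, -c).
  · rw [← integral_cexp_mul_inv_sq_of_lt h, ← integral_neg_eq_self]
    refine integral_congr_ae (ae_of_all _ fun τ => ?_)
    simp only
    congr 2
    · push_cast; ring_nf
    · push_cast; ring

end Fourier

/-! ### The boundary integral -/

section Representation

set_option linter.unusedSectionVars false

variable {V : Type*} [NormedAddCommGroup V] [NormedSpace ℝ V]
  [Module ℍ[ℝ] V] [IsBoundedSMul ℍ[ℝ] V] [IsScalarTower ℝ ℍ[ℝ] V]
  [Module ℍ[ℝ]ᵐᵒᵖ V] [IsBoundedSMul ℍ[ℝ]ᵐᵒᵖ V] [IsScalarTower ℝ ℍ[ℝ]ᵐᵒᵖ V]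
  {U : ℝ → V →L[ℍ[ℝ]ᵐᵒᵖ] V} {M ω σ c : ℝ} {I : ℍ[ℝ]}

lemma norm_exp_neg_smul (t : ℝ) (s : ℍ[ℝ]) :
    ‖NormedSpace.exp (-(t • s))‖ = Real.exp (-t * s.re) := by
  rw [Quaternion.norm_exp, ← Real.exp_eq_exp_ℝ]
  simp

lemma rightLine_re (hI : I ∈ imagUnits) (c τ : ℝ) : (rightLine c I τ).re = c := by
  simp [rightLine, hI.1]

lemma continuous_rightLine (c : ℝ) (I : ℍ[ℝ]) : Continuous (rightLine c I) := by
  unfold rightLine; fun_prop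

lemma continuous_quaternion_exp : Continuous (NormedSpace.exp : ℍ[ℝ] → ℍ[ℝ]) := by
  let := NormedAlgebra.restrictScalars ℚ ℝ ℍ[ℝ]
  exact NormedSpace.exp_continuous

/-- The Laplace integral `∫₀^∞ e^{-zr} U(σr) w dr` at `z = c + Iτ`. -/
noncomputable def lineLaplace (U : ℝ → V →L[ℍ[ℝ]ᵐᵒᵖ] V) (σ c : ℝ) (I : ℍ[ℝ]) (w : V) (τ : ℝ) : V :=
  ∫ r in Set.Ioi 0, NormedSpace.exp (-(r • rightLine c I τ)) • U (σ * r) w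

lemma norm_exp_smul_group_le (hb : HasGrowthBound U M ω) (hσ : |σ| = 1) (hI : I ∈ imagUnits)
    (w : V) (τ : ℝ) {r : ℝ} (hr : 0 < r) :
    ‖NormedSpace.exp (-(r • rightLine c I τ)) • U (σ * r) w‖ ≤
      M * ‖w‖ * Real.exp (-(c - ω) * r) := by
  refine (norm_smul_le _ _).trans ?_
  rw [norm_exp_neg_smul, rightLine_re hI]
  have h1 := hb (σ * r) w
  rw [abs_mul, hσ, one_mul, abs_of_pos hr] at h1
  calc _ ≤ Real.exp (-r * c) * (M * Real.exp (ω * r) * ‖w‖) := by gcongr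
    _ = _ := by rw [show -(c - ω) * r = -r * c + ω * r by ring, Real.exp_add]; ring

lemma continuous_exp_smul_group (hU : IsStronglyContinuousGroup U) (σ c : ℝ) (I : ℍ[ℝ]) (w : V) :
    Continuous fun p : ℝ × ℝ =>
      NormedSpace.exp (-(p.2 • rightLine c I p.1)) • U (σ * p.2) w := by
  have h1 := continuous_rightLine c I
  have h2 := (hU.comp_mul σ).continuous w
  exact (continuous_quaternion_exp.comp (by fun_prop)).smul (h2.comp continuous_snd)

lemma continuous_lineLaplace (hU : IsStronglyContinuousGroup U) (hb : HasGrowthBound U M ω)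
    (hσ : |σ| = 1) (hI : I ∈ imagUnits) (hc : ω < c) (w : V) : Continuous (lineLaplace U σ c I w) := by
  have h := continuous_exp_smul_group hU σ c I w
  refine continuous_of_dominated (bound := fun r => M * ‖w‖ * Real.exp (-(c - ω) * r))
    (fun τ => (h.comp (by fun_prop : Continuous fun r => (τ, r))).aestronglyMeasurable)
    (fun τ => (ae_restrict_iff' measurableSet_Ioi).2 (ae_of_all _ fun r hr =>
      norm_exp_smul_group_le hb hσ hI w τ hr))
    ((integrableOn_exp_mul_Ioi (by linarith) 0).const_mul _)
    (ae_of_all _ fun r => h.comp (by fun_prop : Continuous fun τ => (τ, r)))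

lemma norm_lineLaplace_le (hb : HasGrowthBound U M ω)
    (hσ : |σ| = 1) (hI : I ∈ imagUnits) (hc : ω < c) (w : V) (τ : ℝ) : ‖lineLaplace U σ c I w τ‖ ≤
    ∫ r in Set.Ioi (0 : ℝ), M * ‖w‖ * Real.exp (-(c - ω) * r) :=
  norm_integral_le_of_norm_le ((integrableOn_exp_mul_Ioi (by linarith) 0).const_mul _)
    ((ae_restrict_iff' measurableSet_Ioi).2 (ae_of_all _ fun r hr =>
      norm_exp_smul_group_le hb hσ hI w τ hr))

/-- The weight `((α - s)²)⁻¹` on the line `s = σ(c + Iτ)` comes from the complex plane. -/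
lemma inv_sq_eq_sliceEmbedding (hI : I ∈ imagUnits) (hσ : σ * σ = 1) (α c τ : ℝ) :
    (((α : ℍ[ℝ]) - σ • rightLine c I τ) ^ 2)⁻¹ =
      sliceEmbedding hI ((((σ * α : ℝ) : ℂ) - (c + τ * Complex.I)) ^ 2)⁻¹ := by
  have hα : (α : ℍ[ℝ]) = sliceEmbedding hI (α : ℂ) := by simp
  rw [rightLine_eq hI, hα, ← map_smul, ← map_sub, ← map_pow, ← map_inv₀]
  congr 2
  have h : ((σ : ℂ) * σ) = 1 := by exact_mod_cast hσ
  rw [Complex.real_smul]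
  push_cast
  linear_combination ((α : ℂ) ^ 2 - (c + τ * Complex.I) ^ 2) * (-1 : ℂ) * h

/-- The integrand, at `s = σ(c + Iτ)`, of the boundary integral for `f(s) = e^{-st}`. -/
noncomputable def expIntegrand (U : ℝ → V →L[ℍ[ℝ]ᵐᵒᵖ] V) (α σ c : ℝ) (I : ℍ[ℝ]) (w : V)
    (t τ : ℝ) : V :=
  (NormedSpace.exp (-(t • σ • rightLine c I τ)) * (((α : ℍ[ℝ]) - σ • rightLine c I τ) ^ 2)⁻¹) •
    lineLaplace U σ c I w τ

lemma continuous_inv_sq (hI : I ∈ imagUnits) (hσ : σ * σ = 1) {α : ℝ} (hα : σ * α ≠ c) :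
    Continuous fun τ => (((α : ℍ[ℝ]) - σ • rightLine c I τ) ^ 2)⁻¹ := by
  simp_rw [inv_sq_eq_sliceEmbedding hI hσ]
  refine (continuous_sliceEmbedding hI).comp (Continuous.inv₀ (by fun_prop) fun τ h => ?_)
  have := congrArg Complex.re (pow_eq_zero_iff two_ne_zero |>.1 h)
  simp at this
  exact hα (by linarith)

lemma integrable_norm_inv_sq (hI : I ∈ imagUnits) (hσ : σ * σ = 1) {α : ℝ} (hα : σ * α ≠ c) :
    Integrable fun τ => ‖(((α : ℍ[ℝ]) - σ • rightLine c I τ) ^ 2)⁻¹‖ := by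
  simp_rw [inv_sq_eq_sliceEmbedding hI hσ, norm_sliceEmbedding]
  have h := (integrable_add_mul_I_sq_inv (sub_ne_zero.2 hα.symm)).norm
  refine h.congr (ae_of_all _ fun τ => ?_)
  simp only
  congr 2
  push_cast
  ring

lemma re_smul_rightLine_bound (hI : I ∈ imagUnits) (hσ : |σ| = 1) (hc : 0 ≤ c) (t τ : ℝ) :
    ‖NormedSpace.exp (-(t • σ • rightLine c I τ))‖ ≤ Real.exp (c * |t|) := by
  rw [norm_exp_neg_smul, Quaternion.re_smul, rightLine_re hI]
  apply Real.exp_le_exp.2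
  refine (le_abs_self _).trans_eq ?_
  rw [smul_eq_mul, abs_mul, abs_mul, abs_neg, hσ, abs_of_nonneg hc]; ring

lemma continuous_expIntegrand (hU : IsStronglyContinuousGroup U) (hb : HasGrowthBound U M ω)
    (hσ : σ * σ = 1) (hI : I ∈ imagUnits) (hc : ω < c) {α : ℝ} (hα : σ * α ≠ c) (w : V) :
    Continuous fun p : ℝ × ℝ => expIntegrand U α σ c I w p.1 p.2 := by
  have hσa : |σ| = 1 := by rcases mul_self_eq_one_iff.1 hσ with h | h <;> simp [h]
  have h1 := continuous_rightLine c I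
  have h2 := continuous_lineLaplace hU hb hσa hI hc w
  have h3 := continuous_inv_sq hI hσ hα
  exact ((continuous_quaternion_exp.comp (by fun_prop)).mul (h3.comp continuous_snd)).smul
    (h2.comp continuous_snd)

/-- The integrand is dominated by a product: e^{c|t|} in t, and in τ the integrable |α - s|^{-2}
times a bound of the Laplace integral that is uniform in τ. -/
lemma integrable_expIntegrand (hU : IsStronglyContinuousGroup U) (hb : HasGrowthBound U M ω)
    (hω : 0 ≤ ω) (hσ : σ * σ = 1) (hI : I ∈ imagUnits) (hc : ω < c) {α : ℝ} (hα : σ * α ≠ c)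
    (w : V) (ν : Measure ℝ) [IsFiniteMeasure ν]
    (hν : Integrable (fun t => Real.exp (c * |t|)) ν) :
    Integrable (fun p : ℝ × ℝ => expIntegrand U α σ c I w p.1 p.2) (ν.prod volume) := by
  have hσa : |σ| = 1 := by rcases mul_self_eq_one_iff.1 hσ with h | h <;> simp [h]
  set K := ∫ r in Set.Ioi (0 : ℝ), M * ‖w‖ * Real.exp (-(c - ω) * r)
  have hd := hν.mul_prod ((integrable_norm_inv_sq hI hσ hα).mul_const K)
  refine hd.mono' (continuous_expIntegrand hU hb hσ hI hc hα w).aestronglyMeasurable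
    (ae_of_all _ fun p => ?_)
  refine (norm_smul_le _ _).trans ?_
  rw [norm_mul, mul_assoc]
  have h1 := re_smul_rightLine_bound hI hσa (hω.trans hc.le) p.1 p.2
  have h2 := norm_lineLaplace_le hb hσa hI hc w p.2
  gcongr

/-- After exchanging the τ and r integrals, the scalar factors combine, with z = c + Iτ, to e^{-(σt
+ r)z}(σα - z)^{-2}. Complex inversion at x = σt + r then gives the kernel, because εσ(σt + r) = ε(t
+ σr). The condition |c| < β keeps the pole off both lines and on the side determined by εσ. -/
lemma integral_expIntegrand [CompleteSpace V] (hU : IsStronglyContinuousGroup U) (hb : HasGrowthBound U M ω)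
    (hσ : σ * σ = 1) (hI : I ∈ imagUnits) (hc : ω < c) {α : ℝ} (w : V) {ε β : ℝ}
    (hε : ε * ε = 1) (hαβ : α = ε * β) (hβ : |c| < β) (t : ℝ) :
    ∫ τ, expIntegrand U α σ c I w t τ = (2 * Real.pi) • ∫ r in Set.Ioi 0,
      (max (ε * (t + σ * r)) 0 * Real.exp (-β * (ε * (t + σ * r)))) • U (σ * r) w := by
  have hσa : |σ| = 1 := by rcases mul_self_eq_one_iff.1 hσ with h | h <;> simp [h]
  have hεσ : (ε * σ) * (ε * σ) = 1 := by linear_combination ε * ε * hσ + hε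
  have hεσa : |ε * σ| = 1 := by rcases mul_self_eq_one_iff.1 hεσ with h | h <;> simp [h]
  have hlt : (ε * σ) * c < β := by
    refine (le_abs_self _).trans_lt ?_
    rwa [abs_mul, hεσa, one_mul]
  have hα : σ * α ≠ c := by
    intro h
    rw [hαβ] at h
    have h1 : |c| = |β| := by rw [← h, ← mul_assoc, abs_mul, mul_comm σ ε, hεσa, one_mul]
    rw [h1] at hβ
    exact hβ.not_ge (le_abs_self β)
  let k : ℝ → ℍ[ℝ] := fun τ => NormedSpace.exp (-(t • σ • rightLine c I τ)) *
    (((α : ℍ[ℝ]) - σ • rightLine c I τ) ^ 2)⁻¹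
  let F : ℝ → ℝ → V := fun τ r =>
    k τ • NormedSpace.exp (-(r • rightLine c I τ)) • U (σ * r) w
  have hk : Continuous k := by
    have h1 := continuous_rightLine c I
    exact (continuous_quaternion_exp.comp (by fun_prop)).mul (continuous_inv_sq hI hσ hα)
  have hFint : Integrable (Function.uncurry F) (volume.prod (volume.restrict (Set.Ioi 0))) := by
    have hd := ((integrable_norm_inv_sq hI hσ hα).const_mul (Real.exp (|c| * |t|))).mul_prod
      ((integrableOn_exp_mul_Ioi (show -(c - ω) < 0 by linarith) 0).const_mul (M * ‖w‖))
    have hcont : Continuous (Function.uncurry F) :=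
      (hk.comp continuous_fst).smul (continuous_exp_smul_group hU σ c I w)
    refine hd.mono' hcont.aestronglyMeasurable ?_
    rw [show (volume : Measure ℝ).prod (volume.restrict (Set.Ioi (0 : ℝ))) =
      (volume.prod volume).restrict (Set.univ ×ˢ Set.Ioi 0) by
        rw [← Measure.prod_restrict, Measure.restrict_univ]]
    refine (ae_restrict_iff' (MeasurableSet.univ.prod measurableSet_Ioi)).2
      (ae_of_all _ fun p hp => ?_)
    have h1 : ‖NormedSpace.exp (-(t • σ • rightLine c I p.1))‖ ≤ Real.exp (|c| * |t|) := by
      rw [norm_exp_neg_smul, Quaternion.re_smul, rightLine_re hI]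
      apply Real.exp_le_exp.2
      refine (le_abs_self _).trans_eq ?_
      rw [smul_eq_mul, abs_mul, abs_mul, abs_neg, hσa]; ring
    have h2 := norm_exp_smul_group_le (c := c) hb hσa hI w p.1 hp.2
    refine (norm_smul_le _ _).trans ?_
    simp only [k, norm_mul]
    gcongr
  have e1 : ∀ τ, expIntegrand U α σ c I w t τ = ∫ r in Set.Ioi 0, F τ r := by
    intro τ
    have hi : IntegrableOn (fun r => NormedSpace.exp (-(r • rightLine c I τ)) • U (σ * r) w)
        (Set.Ioi 0) :=
      integrableOn_Ioi_of_norm_le_exp (sub_pos.2 hc)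
        ((continuous_exp_smul_group hU σ c I w).comp (by fun_prop : Continuous fun r => (τ, r)))
        fun r hr => norm_exp_smul_group_le hb hσa hI w τ hr
    exact (Integrable.integral_smul (k τ) hi).symm
  simp_rw [e1]
  rw [integral_integral_swap hFint, ← integral_smul]
  refine setIntegral_congr_fun measurableSet_Ioi fun r hr => ?_
  let z : ℝ → ℂ := fun τ => Complex.exp (-(((σ * t + r : ℝ) : ℂ) * (c + τ * Complex.I))) *
      (((((ε * σ) * β : ℝ) : ℂ) - (c + τ * Complex.I)) ^ 2)⁻¹
  have hz : ∀ τ, F τ r = sliceEmbedding hI (z τ) • U (σ * r) w := by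
    intro τ
    simp only [F, k]
    rw [smul_smul, inv_sq_eq_sliceEmbedding hI hσ, rightLine_eq hI,
      ← map_smul (sliceEmbedding hI), ← map_smul (sliceEmbedding hI),
      ← map_smul (sliceEmbedding hI), ← map_neg, ← map_neg, exp_sliceEmbedding, exp_sliceEmbedding, ← map_mul,
      ← map_mul]
    congr 2
    rw [mul_right_comm, ← Complex.exp_add]
    simp only [z]
    congr 2
    · simp only [Complex.real_smul]; push_cast; ring
    · rw [hαβ]; push_cast; ring
  have hzi : Integrable z := by
    have h := integrable_add_mul_I_sq_inv (p := c - σ * α) (sub_ne_zero.2 hα.symm)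
    refine (h.norm.const_mul (Real.exp (-((σ * t + r) * c)))).mono' ?_ (ae_of_all _ fun τ => ?_)
    · refine Continuous.aestronglyMeasurable (Continuous.mul (by fun_prop)
        (Continuous.inv₀ (by fun_prop) fun τ h => ?_))
      have := congrArg Complex.re (pow_eq_zero_iff two_ne_zero |>.1 h)
      simp at this
      exact hα (by rw [hαβ]; linarith)
    · simp only [z, norm_mul]
      refine mul_le_mul (le_of_eq ?_) (le_of_eq ?_) (norm_nonneg _) (Real.exp_nonneg _)
      · rw [Complex.norm_exp]; simp
      · congr 2
        rw [hαβ]; push_cast; ring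
  have e2 : ∫ τ, F τ r = sliceEmbedding hI (∫ τ, z τ) • U (σ * r) w := by
    let L : ℂ →L[ℝ] V := ((ContinuousLinearMap.lsmul ℝ ℍ[ℝ]).flip (U (σ * r) w)).comp
      ⟨(sliceEmbedding hI).toLinearMap, continuous_sliceEmbedding hI⟩
    have := L.integral_comp_comm hzi
    rw [integral_congr_ae (ae_of_all _ hz)]
    exact this
  rw [e2, integral_cexp_mul_inv_sq hεσ hlt]
  have e3 : ε * σ * (σ * t + r) = ε * (t + σ * r) := by linear_combination ε * t * hσ
  rw [e3, sliceEmbedding_apply]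
  simp only [Complex.ofReal_re, Complex.ofReal_im, zero_smul, add_zero]
  rw [coe_smul_eq, mul_smul]

end Representation

/-! ### Inverting (α - s)^{-2} along the group; the case of one exponential -/

section Representation

set_option linter.unusedSectionVars false

variable {V : Type*} [NormedAddCommGroup V] [NormedSpace ℝ V] [CompleteSpace V]
  [Module ℍ[ℝ] V] [IsBoundedSMul ℍ[ℝ] V] [IsScalarTower ℝ ℍ[ℝ] V]
  [Module ℍ[ℝ]ᵐᵒᵖ V] [IsBoundedSMul ℍ[ℝ]ᵐᵒᵖ V] [IsScalarTower ℝ ℍ[ℝ]ᵐᵒᵖ V]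
  {U : ℝ → V →L[ℍ[ℝ]ᵐᵒᵖ] V} {T : V →ₗ.[ℍ[ℝ]ᵐᵒᵖ] V} {M ω σ c α : ℝ} {I : ℍ[ℝ]}

/-- `u` is the integral along the group of `(α - T)² u` against the inverse Laplace transform of
`(α - s)⁻²`. -/
lemma integral_group_realShiftSq (hU : IsStronglyContinuousGroup U) (hb : HasGrowthBound U M ω)
    (hT : IsGenerator U T) {ε β : ℝ} (hε : ε * ε = 1) (hαβ : α = ε * β) (hβ : ω < β)
    (u : domSq T) :
    Integrable (fun y => (max (ε * y) 0 * Real.exp (-β * (ε * y))) • U y (realShiftSq T α u)) ∧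
    ∫ y, (max (ε * y) 0 * Real.exp (-β * (ε * y))) • U y (realShiftSq T α u) = (u : V) := by
  have hεa : |ε| = 1 := by rcases mul_self_eq_one_iff.1 hε with h | h <;> simp [h]
  have hε0 : ε ≠ 0 := fun h => by simp [h] at hε
  have hε' : ∀ x : V, ε • ε • x = x := fun x => by rw [smul_smul, hε, one_smul]
  have hεα : ε * α = β := by rw [hαβ, ← mul_assoc, hε, one_mul]
  set w := realShiftSq T α u with hw
  let x₁ : T.domain := ⟨realShift T α ⟨u, u.2.1⟩,
    T.domain.sub_mem (T.domain.smul_of_tower_mem α u.2.1) u.2.2⟩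
  have hw' : w = α • (x₁ : V) - T x₁ := rfl
  have hx₁ : (x₁ : V) = α • (u : V) - T ⟨u, u.2.1⟩ := rfl
  -- For the generator A = εT of t ↦ U(εt) one has β - A = ε(α - T), so (β - A)² = (α - T)²; the
  -- intermediate vector is ε • x₁.
  have d1 : HasDerivAt (fun t => U (ε * t) (u : V)) (β • (u : V) - ε • (x₁ : V)) 0 := by
    refine (hasDerivAt_comp_mul (hT.hasDerivAt hU hb ⟨u, u.2.1⟩) ε).congr_deriv ?_
    rw [hx₁, ← hεα]
    module
  have d2 : HasDerivAt (fun t => U (ε * t) (ε • (x₁ : V))) (β • (ε • (x₁ : V)) - w) 0 := by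
    have := (hasDerivAt_comp_mul (hT.hasDerivAt hU hb x₁) ε).const_smul ε
    rw [hε'] at this
    refine (this.congr_of_eventuallyEq (Eventually.of_forall fun t => ?_)).congr_deriv ?_
    · exact ((U (ε * t)).restrictScalars ℝ).map_smul ε (x₁ : V)
    · rw [hw', smul_smul, mul_comm β ε, ← hαβ]; abel
  obtain ⟨i1, e1⟩ := integral_mul_exp_smul_group (hU.comp_mul ε) (hb.comp_mul hεa) hβ d1 d2
  have hind : (fun r => (max r 0 * Real.exp (-β * r)) • U (ε * r) w) =
      (Set.Ioi 0).indicator fun r => (r * Real.exp (-β * r)) • U (ε * r) w := by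
    ext r
    rcases le_or_gt r 0 with hr | hr
    · simp [max_eq_right hr, Set.indicator_of_notMem (show r ∉ Set.Ioi 0 by simpa using hr)]
    · rw [Set.indicator_of_mem (show r ∈ Set.Ioi 0 from hr), max_eq_left hr.le]
  have i2 : Integrable fun r => (max r 0 * Real.exp (-β * r)) • U (ε * r) w := by
    rw [hind]; exact i1.integrable_indicator measurableSet_Ioi
  have e2 : ∫ r, (max r 0 * Real.exp (-β * r)) • U (ε * r) w = (u : V) := by
    rw [hind, integral_indicator measurableSet_Ioi, e1]
  have hcomp : (fun y => (max (ε * y) 0 * Real.exp (-β * (ε * y))) • U y w) = fun y =>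
      (fun r => (max r 0 * Real.exp (-β * r)) • U (ε * r) w) (ε * y) := by
    ext y
    simp only [← mul_assoc ε ε, hε, one_mul]
  rw [hcomp]
  refine ⟨i2.comp_mul_left' hε0, ?_⟩
  rw [Measure.integral_comp_mul_left (fun r => (max r 0 * Real.exp (-β * r)) • U (ε * r) w) ε, e2,
    abs_inv, hεa, inv_one, one_smul]

/-- The boundary integral for `f(s) = e^{-st}`. -/
lemma integral_expIntegrand_add (hU : IsStronglyContinuousGroup U) (hb : HasGrowthBound U M ω)
    (hT : IsGenerator U T) (hω : 0 ≤ ω) (hc : ω < c) (hα : c < |α|) (hI : I ∈ imagUnits)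
    (u : domSq T) (t : ℝ) :
    (∫ τ, expIntegrand U α 1 c I (realShiftSq T α u) t τ) +
      ∫ τ, expIntegrand U α (-1) c I (realShiftSq T α u) t τ =
    (2 * Real.pi) • U (-t) (u : V) := by
  obtain ⟨ε, hε, hαβ⟩ : ∃ ε : ℝ, ε * ε = 1 ∧ α = ε * |α| := by
    rcases abs_choice α with h | h
    · exact ⟨1, by norm_num, by rw [h]; ring⟩
    · exact ⟨-1, by norm_num, by rw [h]; ring⟩
  have hcβ : |c| < |α| := by rwa [abs_of_nonneg (hω.trans hc.le)]
  set β := |α| with hβ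
  set w := realShiftSq T α u with hw
  obtain ⟨i1, e1⟩ := integral_group_realShiftSq hU hb hT hε hαβ (hc.trans hα) u
  rw [integral_expIntegrand hU hb (by norm_num) hI hc w hε hαβ hcβ t,
    integral_expIntegrand hU hb (by norm_num) hI hc w hε hαβ hcβ t, ← smul_add]
  congr 1
  let G : ℝ → V := fun r =>
    (max (ε * (t + r)) 0 * Real.exp (-β * (ε * (t + r)))) • U r w
  -- With y = t + r, U(r) = U(-t)U(y); the kernel is real, so U(-t) can be taken out of the
  -- integral.
  have hG : G = fun r => (fun y => (U (-t)).restrictScalars ℝ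
      ((max (ε * y) 0 * Real.exp (-β * (ε * y))) • U y w)) (t + r) := by
    ext r
    simp only [G, map_smul, ContinuousLinearMap.coe_restrictScalars', ← hU.add,
      neg_add_cancel_left]
  have iG : Integrable G := by
    rw [hG]
    exact (((U (-t)).restrictScalars ℝ).integrable_comp i1).comp_add_left t
  have eG : ∫ r, G r = U (-t) (u : V) := by
    rw [hG, integral_add_left_eq_self (fun y => (U (-t)).restrictScalars ℝ
      ((max (ε * y) 0 * Real.exp (-β * (ε * y))) • U y w)) t,
      ContinuousLinearMap.integral_comp_comm _ i1, e1]
    rfl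
  -- The right line supplies the half r > 0 and the left line, after r ↦ -r, the half r ≤ 0.
  rw [← eG, ← integral_add_compl (measurableSet_Ioi (a := (0 : ℝ))) iG, Set.compl_Ioi]
  congr 1
  · simp only [one_mul, G]
  · have := integral_comp_neg_Ioi 0 G
    rw [neg_zero] at this
    rw [← this]
    simp only [neg_one_mul, G]

/-- On the line `s = σ(c + Iτ)` the integrand of the boundary integral is
`F(s) • ∫₀^∞ e^{-σsr} U(σr) w dr`. -/
lemma sliceIntegrand_eq (hU : IsStronglyContinuousGroup U) (hb : HasGrowthBound U M ω)
    (hT : IsGenerator U T) (hσ : σ * σ = 1) (hc : ω < c) (hI : I ∈ imagUnits)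
    (F : ℍ[ℝ] → ℍ[ℝ]) (w : V) (τ : ℝ) :
    sliceIntegrand I (fun τ => σ • rightLine c I τ) F (fun s => rightSResolvent T s w) τ =
      F (σ • rightLine c I τ) • lineLaplace U σ c I w τ := by
  have hd : deriv (fun τ => σ • rightLine c I τ) τ = σ • I := by
    have h1 : HasDerivAt (fun τ : ℝ => σ • rightLine c I τ) (σ • ((1 : ℝ) • I)) τ :=
      (((hasDerivAt_id τ).smul_const I).const_add (c : ℍ[ℝ])).const_smul σ
    rw [h1.deriv, one_smul]
  unfold sliceIntegrand
  simp only [hd]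
  rw [ (smul_rightLine_mem_and_eq hU hb hT hσ hc τ hI).2 w, smul_mul_assoc,
    mul_self_of_mem_imagUnits hI, smul_neg, neg_neg, mul_smul_comm, mul_one, smul_assoc,
    smul_comm (F _) σ, smul_smul, hσ, one_smul]
  rfl

end Representation

lemma coe_mem_closure_strip {c : ℝ} (hc : 0 < c) : (c : ℍ[ℝ]) ∈ closure (strip c) := by
  have h1 : Tendsto (fun x : ℝ => (x : ℍ[ℝ])) (𝓝[<] c) (𝓝 (c : ℍ[ℝ])) :=
    (Quaternion.continuous_coe.tendsto c).mono_left nhdsWithin_le_nhds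
  refine mem_closure_of_tendsto h1 ?_
  filter_upwards [Ioo_mem_nhdsLT (show -c < c by linarith)] with x hx
  simpa [strip] using hx

/-! ### Fubini on one boundary line -/

section Representation

set_option linter.unusedSectionVars false

variable {V : Type*} [NormedAddCommGroup V] [NormedSpace ℝ V] [CompleteSpace V]
  [Module ℍ[ℝ] V] [IsBoundedSMul ℍ[ℝ] V] [IsScalarTower ℝ ℍ[ℝ] V]
  [Module ℍ[ℝ]ᵐᵒᵖ V] [IsBoundedSMul ℍ[ℝ]ᵐᵒᵖ V] [IsScalarTower ℝ ℍ[ℝ]ᵐᵒᵖ V]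
  {U : ℝ → V →L[ℍ[ℝ]ᵐᵒᵖ] V} {M ω σ c α : ℝ} {I : ℍ[ℝ]}

lemma integrable_exp_neg_smul (hI : I ∈ imagUnits) (hσ : |σ| = 1) (hc : 0 ≤ c) {ν : Measure ℝ}
    (hν : Integrable (fun t => Real.exp (c * |t|)) ν) (τ : ℝ) :
    Integrable (fun t : ℝ => NormedSpace.exp (-(t • σ • rightLine c I τ))) ν :=
  hν.mono' (continuous_quaternion_exp.comp (by fun_prop)).aestronglyMeasurable
    (ae_of_all _ fun t => re_smul_rightLine_bound hI hσ hc t τ)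

/-- The integral over one boundary line for a combination of positive measures. -/
lemma integrable_and_integral_line {ι : Type*} [Fintype ι] (hU : IsStronglyContinuousGroup U)
    (hb : HasGrowthBound U M ω) (hω : 0 ≤ ω) (hσ : σ * σ = 1) (hI : I ∈ imagUnits) (hc : ω < c)
    (hα : c < |α|) (w : V) (ν : ι → Measure ℝ) [∀ j, IsFiniteMeasure (ν j)] (q : ι → ℍ[ℝ])
    (hν : ∀ j, Integrable (fun t => Real.exp (c * |t|)) (ν j)) {f : ℍ[ℝ] → ℍ[ℝ]}
    (hf : ∀ τ, f (σ • rightLine c I τ) =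
      ∑ j, q j * ∫ t, NormedSpace.exp (-(t • σ • rightLine c I τ)) ∂(ν j)) :
    Integrable (fun τ => (f (σ • rightLine c I τ) *
      (((α : ℍ[ℝ]) - σ • rightLine c I τ) ^ 2)⁻¹) • lineLaplace U σ c I w τ) ∧
    (∀ j, Integrable (fun t => ∫ τ, expIntegrand U α σ c I w t τ) (ν j)) ∧
    ∫ τ, (f (σ • rightLine c I τ) *
      (((α : ℍ[ℝ]) - σ • rightLine c I τ) ^ 2)⁻¹) • lineLaplace U σ c I w τ =
    ∑ j, q j • ∫ t, (∫ τ, expIntegrand U α σ c I w t τ) ∂(ν j) := by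
  have hσa : |σ| = 1 := by rcases mul_self_eq_one_iff.1 hσ with h | h <;> simp [h]
  have hα' : σ * α ≠ c := by
    intro h
    have h1 : |σ * α| = |c| := by rw [h]
    rw [abs_mul, hσa, one_mul, abs_of_nonneg (hω.trans hc.le)] at h1
    exact hα.ne' h1
  have hE := fun j => integrable_expIntegrand hU hb hω hσ hI hc hα' w (ν j) (hν j)
  have hτ : ∀ τ, (f (σ • rightLine c I τ) *
      (((α : ℍ[ℝ]) - σ • rightLine c I τ) ^ 2)⁻¹) • lineLaplace U σ c I w τ =
      ∑ j, q j • ∫ t, expIntegrand U α σ c I w t τ ∂(ν j) := by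
    intro τ
    rw [hf, Finset.sum_mul, Finset.sum_smul]
    refine Finset.sum_congr rfl fun j _ => ?_
    rw [mul_assoc, mul_smul]
    congr 1
    -- The weight and the Laplace integral do not depend on t, so multiplying by them is a bounded
    -- real linear map that passes under the integral in t.
    let L : ℍ[ℝ] →L[ℝ] V :=
      ((ContinuousLinearMap.lsmul ℝ ℍ[ℝ]).flip (lineLaplace U σ c I w τ)).comp
        ((ContinuousLinearMap.mul ℝ ℍ[ℝ]).flip (((α : ℍ[ℝ]) - σ • rightLine c I τ) ^ 2)⁻¹)
    exact (L.integral_comp_comm (integrable_exp_neg_smul hI hσa (hω.trans hc.le) (hν j) τ)).symm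
  simp_rw [hτ]
  have hi : ∀ j, Integrable (fun τ => q j • ∫ t, expIntegrand U α σ c I w t τ ∂(ν j)) :=
    fun j => (hE j).integral_prod_right.smul (q j)
  refine ⟨integrable_finsetSum _ fun j _ => hi j, fun j => (hE j).integral_prod_left, ?_⟩
  rw [integral_finsetSum _ fun j _ => hi j]
  refine Finset.sum_congr rfl fun j _ => ?_
  rw [Integrable.integral_smul (q j) (hE j).integral_prod_right]
  congr 1
  exact (integral_integral_swap (hE j)).symm

end Representation
end QuatCalc

/-! ### Assembly of the representation formula -/

open QuatCalc in
theorem proposition4p3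
    {V : Type*} [NormedAddCommGroup V] [NormedSpace ℝ V] [CompleteSpace V]
    [Module ℍ[ℝ] V] [IsBoundedSMul ℍ[ℝ] V] [IsScalarTower ℝ ℍ[ℝ] V]
    [Module ℍ[ℝ]ᵐᵒᵖ V] [IsBoundedSMul ℍ[ℝ]ᵐᵒᵖ V] [IsScalarTower ℝ ℍ[ℝ]ᵐᵒᵖ V]
    [SMulCommClass ℍ[ℝ] ℍ[ℝ]ᵐᵒᵖ V]
    (U : ℝ → V →L[ℍ[ℝ]ᵐᵒᵖ] V) (hU : QuatCalc.IsStronglyContinuousGroup U)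
    (T : V →ₗ.[ℍ[ℝ]ᵐᵒᵖ] V) (hT : QuatCalc.IsGenerator U T)
    (M ω : ℝ) (hM : 0 < M) (hω : 0 ≤ ω)
    (hbound : ∀ (t : ℝ) (v : V), ‖U t v‖ ≤ M * Real.exp (ω * |t|) * ‖v‖)
    (α c : ℝ) (hc : ω < c) (hα : c < |α|)
    (μ : VectorMeasure ℝ ℍ[ℝ]) (D : Set ℍ[ℝ]) (f : ℍ[ℝ] → ℍ[ℝ])
    (hf : QuatCalc.IsLaplaceStieltjesTransform ω μ D f)
    (hreg : QuatCalc.RightSliceRegularNear D f (closure (QuatCalc.strip c)))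
    (I : ℍ[ℝ]) (hI : I ∈ QuatCalc.imagUnits)
    (u : QuatCalc.domSq T) :
    (∀ τ : ℝ, QuatCalc.rightLine c I τ ∈ QuatCalc.sResolventSet T ∧
      QuatCalc.leftLine c I τ ∈ QuatCalc.sResolventSet T) ∧
    μ.Integrable (fun t : ℝ => U (-t) (u : V)) ∧
    QuatCalc.StripBoundaryIntegrable c I (fun s => f s * (((α : ℍ[ℝ]) - s) ^ 2)⁻¹)
      (fun s => QuatCalc.rightSResolvent T s (QuatCalc.realShiftSq T α u)) ∧
    QuatCalc.laplaceCalculus U μ (u : V) =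
      (1 / (2 * Real.pi)) •
        QuatCalc.stripBoundaryIntegral c I (fun s => f s * (((α : ℍ[ℝ]) - s) ^ 2)⁻¹)
          (fun s => QuatCalc.rightSResolvent T s (QuatCalc.realShiftSq T α u)) := by
  have hb : HasGrowthBound U M ω := hbound
  have h1 : (1 : ℝ) * 1 = 1 := by norm_num
  have h2 : (-1 : ℝ) * (-1) = 1 := by norm_num
  obtain ⟨ε, hε, hmom, rfl, hfs⟩ := hf
  obtain ⟨O, hKO, hOD, -⟩ := hreg
  have hc0 : 0 < c := hω.trans_lt hc
  -- The boundary point c of the strip lies in the domain of `f`, an open strip of half-width ω + ε,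
  -- so the inequality is strict. It provides the moment e^{c|t|} needed on the lines.
  have hcε : c < ω + ε := by simpa using (hOD (hKO (coe_mem_closure_strip hc0))).2
  have hmom' : ∀ a ≤ ω + ε, Integrable (fun t : ℝ => Real.exp (a * |t|)) μ.variation := fun a ha =>
    hmom.mono' (by fun_prop) (ae_of_all _ fun t => by
      rw [Real.norm_eq_abs, Real.abs_exp]
      gcongr)
  -- The moment with exponent 0 is the total mass of |μ|.
  have hfin : IsFiniteMeasure μ.variation := by
    have := hmom' 0 (by linarith)
    simpa [integrable_const_iff] using this
  have hUint : Integrable (fun t : ℝ => U (-t) (u : V)) μ.variation := by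
    refine ((hmom' ω (by linarith)).const_mul (M * ‖(u : V)‖)).mono'
      ((hU.continuous (u : V)).comp continuous_neg).aestronglyMeasurable (ae_of_all _ fun t => ?_)
    refine (hbound (-t) u).trans_eq ?_
    rw [abs_neg]; ring
  obtain ⟨n, ν, q, C, hνfin, hνle, hμ⟩ := exists_eq_sum_measure_smul μ
  have hν := fun j => Integrable.of_measure_le_smul (c := (C : ENNReal)) (by simp) (hνle j)
    (hmom' c hcε.le)
  have hline : ∀ σ : ℝ, σ * σ = 1 → ∀ τ, f (σ • rightLine c I τ) =
      ∑ j, q j * ∫ t, NormedSpace.exp (-(t • σ • rightLine c I τ)) ∂(ν j) := by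
    intro σ hσ τ
    have hσa : |σ| = 1 := by rcases mul_self_eq_one_iff.1 hσ with h | h <;> simp [h]
    have hmem : σ • rightLine c I τ ∈ strip (ω + ε) := by
      have h : |(σ • rightLine c I τ).re| < ω + ε := by
        rw [Quaternion.re_smul, rightLine_re hI, smul_eq_mul, abs_mul, hσa, one_mul,
          abs_of_pos hc0]
        exact hcε
      exact abs_lt.1 h
    rw [hfs _ hmem, laplaceStieltjes, vectorMeasure_integral_eq_sum μ ν q C hνle hμ _
      (integrable_exp_neg_smul hI hσa hc0.le (hmom' c hcε.le) τ)]
    rfl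
  set w := realShiftSq T α u with hw
  obtain ⟨iR, jR, eR⟩ := integrable_and_integral_line hU hb hω h1 hI hc hα w ν q hν (hline 1 h1)
  obtain ⟨iL, jL, eL⟩ :=
    integrable_and_integral_line hU hb hω h2 hI hc hα w ν q hν (hline (-1) h2)
  have hR : rightLine c I = fun τ => (1 : ℝ) • rightLine c I τ := by simp
  have hL : leftLine c I = fun τ => (-1 : ℝ) • rightLine c I τ := funext fun τ => leftLine_eq c τ
  have sR : sliceIntegrand I (rightLine c I) (fun s => f s * (((α : ℍ[ℝ]) - s) ^ 2)⁻¹)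
      (fun s => rightSResolvent T s w) = fun τ => (f ((1 : ℝ) • rightLine c I τ) *
      (((α : ℍ[ℝ]) - (1 : ℝ) • rightLine c I τ) ^ 2)⁻¹) • lineLaplace U 1 c I w τ := by
    conv_lhs => rw [hR]
    exact funext fun τ => sliceIntegrand_eq hU hb hT h1 hc hI _ w τ
  have sL : sliceIntegrand I (leftLine c I) (fun s => f s * (((α : ℍ[ℝ]) - s) ^ 2)⁻¹)
      (fun s => rightSResolvent T s w) = fun τ => (f ((-1 : ℝ) • rightLine c I τ) *
      (((α : ℍ[ℝ]) - (-1 : ℝ) • rightLine c I τ) ^ 2)⁻¹) • lineLaplace U (-1) c I w τ := by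
    rw [hL]
    exact funext fun τ => sliceIntegrand_eq hU hb hT h2 hc hI _ w τ
  refine ⟨fun τ => ⟨?_, ?_⟩, hUint, ⟨?_, ?_⟩, ?_⟩
  · simpa using (smul_rightLine_mem_and_eq hU hb hT h1 hc τ hI).1
  · rw [leftLine_eq]
    exact (smul_rightLine_mem_and_eq hU hb hT h2 hc τ hI).1
  · rw [sR]; exact iR
  · rw [sL]; exact iL
  · rw [stripBoundaryIntegral, sR, sL, eR, eL, ← Finset.sum_add_distrib, laplaceCalculus,
      vectorMeasure_integral_eq_sum μ ν q C hνle hμ _ hUint, Finset.smul_sum]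
    refine Finset.sum_congr rfl fun j _ => ?_
    rw [← smul_add, ← integral_add (jR j) (jL j)]
    -- For each t the two lines together give 2π U(-t)u; the real factor 2π commutes with `q j` and
    -- cancels the prefactor.
    have key := integral_expIntegrand_add hU hb hT hω hc hα hI u
    simp only [← hw] at key
    simp_rw [key, integral_smul]
    rw [smul_comm (q j), smul_smul, one_div, inv_mul_cancel₀ Real.two_pi_pos.ne', one_smul]
    rfl
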